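/- For $X,Y\in M(n,\mathbb{C})$ let $[X,Y]=XY-YX$ and let $\|X\|^2=\operatorname{tr}(XX^*)$ be the squared Frobenius norm; $\overline X$ is the entrywise complex conjugate and $X^*=\overline X^{\,t}$. For real orthogonal $P\in O(n)$, $R=(R_{jk})\in O(N)$ and a tuple $(A_1,\dots,A_N)$ of matrices in $M(n,\mathbb{C})$, put $$(P,R)\cdot(A_1,\dots,A_N)=\Big(\sum_{j=1}^N R_{j1}P^*A_jP,\ \dots,\ \sum_{j=1}^N R_{jN}P^*A_jP\Big).$$ For a $k\times k$ matrix $X$ with $k\le n$, $\operatorname{diag}(X,0)$ is the $n\times n$ matrix with $X$ in the upper left corner and zeros elsewhere. Let $m\ge 3$ and let $B_1,\dots,B_m$ be $n\times n$ complex skew-symmetric matrices ($B_r^t=-B_r$). For $1\le r\le m$ let $A_r^1=\frac12(B_r+\overline{B_r})$ and $A_r^2=\frac1{2\mathbf i}(B_r-\overline{B_r})$. (1) If $n=3$, then $$\sum_{r,s=1}^m\|[B_r,B_s]\|^2\le\frac13\Big(\sum_{r=1}^m\|B_r\|^2\Big)^2.$$ Equality holds if and only if $\sum_{r=1}^m[B_r,\overline{B_r}]=0$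 and there exist $P\in O(n)$, $R\in O(2m)$ and $\lambda\ge0$ such that $$(P,R)\cdot(A_1^1,\dots,A_m^1,A_1^2,\dots,A_m^2)=(C_1,C_2,C_3,0,\dots,0),$$ where $$C_1=\begin{pmatrix}0&\lambda&0\\-\lambda&0&0\\0&0&0\end{pmatrix},\quad C_2=\begin{pmatrix}0&0&\lambda\\0&0&0\\-\lambda&0&0\end{pmatrix},\quad C_3=\begin{pmatrix}0&0&0\\0&0&\lambda\\0&-\lambda&0\end{pmatrix}.$$ (2) If $n\ge4$, then $$\sum_{r,s=1}^m\|[B_r,B_s]\|^2\le\frac23\Big(\sum_{r=1}^m\|B_r\|^2\Big)^2.$$ Equality holds if and only if $\sum_{r=1}^m[B_r,\overline{B_r}]=0$ and there exist $P\in O(n)$, $R\in O(2m)$ and $\lambda\ge0$ such that $$(P,R)\cdot(A_1^1,\dots,A_m^1,A_1^2,\dots,A_m^2)=(\operatorname{diag}(D_1,0),\operatorname{diag}(D_2,0),\operatorname{diag}(D_3,0),0,\dots,0),$$ where $$D_1=\begin{pmatrix}0&\lambda&0&0\\-\lambda&0&0&0\\0&0&0&\lambda\\0&0&-\lambda&0\end{pmatrix},\quad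 D_2=\begin{pmatrix}0&0&\lambda&0\\0&0&0&-\lambda\\-\lambda&0&0&0\\0&\lambda&0&0\end{pmatrix},\quad D_3=\begin{pmatrix}0&0&0&\lambda\\0&0&\lambda&0\\0&-\lambda&0&0\\-\lambda&0&0&0\end{pmatrix}.$$ -/

import Mathlib

open scoped ComplexConjugate Matrix

-- The norm on matrices is the Frobenius norm, `‖B‖ ^ 2 = tr (B * Bᴴ)`.
attribute [local instance] Matrix.frobeniusNormedAddCommGroup

namespace DDVV

/-- The entrywise complex conjugate of a matrix. -/
def conjMatrix {n : ℕ} (B : Matrix (Fin n) (Fin n) ℂ) : Matrix (Fin n) (Fin n) ℂ :=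
  B.map (starRingEnd ℂ)

/-- The entrywise real part `(B + conj B) / 2`, as a complex matrix. -/
noncomputable def realPart {n : ℕ} (B : Matrix (Fin n) (Fin n) ℂ) : Matrix (Fin n) (Fin n) ℂ :=
  (1 / 2 : ℂ) • (B + conjMatrix B)

/-- The entrywise imaginary part `(B - conj B) / (2 i)`, as a complex matrix. -/
noncomputable def imagPart {n : ℕ} (B : Matrix (Fin n) (Fin n) ℂ) : Matrix (Fin n) (Fin n) ℂ :=
  (1 / (2 * Complex.I) : ℂ) • (B - conjMatrix B)

/-- The `2m`-tuple consisting of the `m` real parts followed by the `m` imaginary parts. -/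
noncomputable def parts {m n : ℕ} (B : Fin m → Matrix (Fin n) (Fin n) ℂ) :
    Fin (m + m) → Matrix (Fin n) (Fin n) ℂ :=
  Fin.append (fun r => realPart (B r)) (fun r => imagPart (B r))

/-- The group `U(n) × O(N)`. -/
abbrev K (n N : ℕ) : Type :=
  Matrix.unitaryGroup (Fin n) ℂ × Matrix.orthogonalGroup (Fin N) ℝ

/-- `(P, R) · (A_1, …, A_N)` is the tuple whose `k`-th entry is `∑ j, R_{jk} P* A_j P`. -/
noncomputable def act {n N : ℕ} (g : K n N) (A : Fin N → Matrix (Fin n) (Fin n) ℂ) :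
    Fin N → Matrix (Fin n) (Fin n) ℂ :=
  fun k => ∑ j, (((g.2 : Matrix (Fin N) (Fin N) ℝ) j k : ℝ) : ℂ) •
    ((g.1 : Matrix (Fin n) (Fin n) ℂ)ᴴ * A j * (g.1 : Matrix (Fin n) (Fin n) ℂ))

/-- The unitary matrix `P` lies in the real orthogonal group `O(n)`. -/
def IsRealOrthogonal {n : ℕ} (P : Matrix.unitaryGroup (Fin n) ℂ) : Prop :=
  ∃ Q ∈ Matrix.orthogonalGroup (Fin n) ℝ,
    (P : Matrix (Fin n) (Fin n) ℂ) = Q.map (fun x : ℝ => (x : ℂ))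

/-- The `n × n` block matrix `diag(X, 0)` with the `k × k` matrix `X` in the upper left corner
(used for `k ≤ n`). -/
def diagZero {k : ℕ} (n : ℕ) (X : Matrix (Fin k) (Fin k) ℂ) : Matrix (Fin n) (Fin n) ℂ :=
  Matrix.of fun i j =>
    if h : (i : ℕ) < k ∧ (j : ℕ) < k then X ⟨i, h.1⟩ ⟨j, h.2⟩ else 0

/-- The `N`-tuple `(X, Y, Z, 0, …, 0)` (used for `3 ≤ N`). -/
def triple {n : ℕ} (N : ℕ) (X Y Z : Matrix (Fin n) (Fin n) ℂ) :
    Fin N → Matrix (Fin n) (Fin n) ℂ :=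
  fun k => if (k : ℕ) = 0 then X else if (k : ℕ) = 1 then Y else if (k : ℕ) = 2 then Z else 0

def C₁ (t : ℂ) : Matrix (Fin 3) (Fin 3) ℂ :=
  !![0, t, 0;
     -t, 0, 0;
     0, 0, 0]

def C₂ (t : ℂ) : Matrix (Fin 3) (Fin 3) ℂ :=
  !![0, 0, t;
     0, 0, 0;
     -t, 0, 0]

def C₃ (t : ℂ) : Matrix (Fin 3) (Fin 3) ℂ :=
  !![0, 0, 0;
     0, 0, t;
     0, -t, 0]

def D₁ (t : ℂ) : Matrix (Fin 4) (Fin 4) ℂ :=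
  !![0, t, 0, 0;
     -t, 0, 0, 0;
     0, 0, 0, t;
     0, 0, -t, 0]

def D₂ (t : ℂ) : Matrix (Fin 4) (Fin 4) ℂ :=
  !![0, 0, t, 0;
     0, 0, 0, -t;
     -t, 0, 0, 0;
     0, t, 0, 0]

def D₃ (t : ℂ) : Matrix (Fin 4) (Fin 4) ℂ :=
  !![0, 0, 0, t;
     0, 0, t, 0;
     0, -t, 0, 0;
     -t, 0, 0, 0]

end DDVV

namespace DDVV

/-! Passing to real and imaginary parts reduces the claim to real skew-symmetric matrices. The
commutator sum of the `2m` real parts equals that of the `B r` plus half of the squared norm of `∑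
[B r, conj (B r)]` (`sum_frobSq_lie_realTuple`), and the total squared norms agree. So the real
inequality implies the complex one, and complex equality means real equality together with the
vanishing of that sum.

For real tuples both sides are invariant under conjugation by an orthogonal `P` and under orthogonal
mixing `R` of the members. Diagonalizing the Gram matrix makes the members mutually orthogonal, `A'
r = √(x r) • Q r` with `Q r` orthonormal wherever `x r > 0`. It remains to bound the quadratic form
`∑ x r * x s * ‖[Q r, Q s]‖²` by `2/3 * (∑ x r)²`. By `weighted_sum_le` it suffices that, for each
`r`, the excesses `‖[Q r, Q s]‖² - 2/3` over any set of `s ≠ r` add up to at most `2/3`.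

That bound is `sum_frobSq_lie_sub_le`. In an eigenbasis of `Q`, with eigenvalues `-iθ a`, the
commutator with `Q` multiplies the `(a, b)` coefficient by a number of modulus `|θ a + θ b|`.
Bessel's inequality caps the total weight at each `(a, b)` by `1/2`, and the symmetry of the
spectrum leaves an elementary inequality on the `θ a`.

Equality forces every `θ a` into `{0, 1/2, -1/2}`, exactly three nonzero members of equal norm, and
quaternion relations among them; a unit vector in their common range and its images then give the
basis that displays the model matrices.

In size three a skew matrix is a vector of `ℝ³` and the bracket a cross product, so the sharper
constant `1/3` follows from Lagrange's identity and a sum of squares. -/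

/-- The squared Frobenius norm, as a sum of squared entries. -/
noncomputable def frobSq {𝕜 : Type*} [RCLike 𝕜] {n : ℕ} (M : Matrix (Fin n) (Fin n) 𝕜) : ℝ :=
  ∑ i, ∑ j, ‖M i j‖ ^ 2

/-! ### Frobenius norm and its unitary invariance. -/

section Basic
variable {𝕜 : Type*} [RCLike 𝕜] {n : ℕ}

lemma norm_sq_eq_frobSq (M : Matrix (Fin n) (Fin n) ℂ) : ‖M‖ ^ 2 = frobSq M := by
  have h0 : 0 ≤ ∑ i, ∑ j, ‖M i j‖ ^ (2 : ℝ) := by positivity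
  rw [Matrix.frobenius_norm_def, ← Real.rpow_natCast, ← Real.rpow_mul h0]
  norm_num [frobSq]

lemma frobSq_nonneg (M : Matrix (Fin n) (Fin n) 𝕜) : 0 ≤ frobSq M := by
  unfold frobSq; positivity

lemma frobSq_eq_zero {M : Matrix (Fin n) (Fin n) 𝕜} (h : frobSq M = 0) : M = 0 := by
  ext i j
  unfold frobSq at h
  have h1 := (Finset.sum_eq_zero_iff_of_nonneg (fun i _ => by positivity)).1 h i (Finset.mem_univ i)
  have h2 := (Finset.sum_eq_zero_iff_of_nonneg (fun i _ => by positivity)).1 h1 j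
    (Finset.mem_univ j)
  simpa using h2

@[simp] lemma frobSq_zero : frobSq (0 : Matrix (Fin n) (Fin n) 𝕜) = 0 := by
  simp [frobSq]

lemma frobSq_neg (M : Matrix (Fin n) (Fin n) 𝕜) : frobSq (-M) = frobSq M := by
  simp [frobSq]

lemma frobSq_smul (c : ℝ) (M : Matrix (Fin n) (Fin n) ℝ) : frobSq (c • M) = c ^ 2 * frobSq M := by
  simp [frobSq, Finset.mul_sum, mul_pow]

lemma coe_frobSq (M : Matrix (Fin n) (Fin n) 𝕜) :
    (frobSq M : 𝕜) = Matrix.trace (M * Mᴴ) := by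
  simp [frobSq, Matrix.trace, Matrix.mul_apply, RCLike.mul_conj]

lemma frobSq_unitary_mul_mul {U V : Matrix (Fin n) (Fin n) 𝕜} (hU : Uᴴ * U = 1)
    (hV : V * Vᴴ = 1) (M : Matrix (Fin n) (Fin n) 𝕜) : frobSq (U * M * V) = frobSq M := by
  have h : (frobSq (U * M * V) : 𝕜) = (frobSq M : 𝕜) := by
    rw [coe_frobSq, coe_frobSq, Matrix.conjTranspose_mul, Matrix.conjTranspose_mul,
      show U * M * V * (Vᴴ * (Mᴴ * Uᴴ)) = U * M * (V * Vᴴ) * Mᴴ * Uᴴ by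
        simp only [Matrix.mul_assoc], hV, Matrix.mul_one, Matrix.trace_mul_comm,
      show Uᴴ * (U * M * Mᴴ) = (Uᴴ * U) * (M * Mᴴ) by simp only [Matrix.mul_assoc], hU,
      Matrix.one_mul]
  exact_mod_cast h

end Basic

/-! ### Reduction from complex matrices to their real and imaginary parts. -/

section Reduction
variable {n m : ℕ}

/-- Both sides expand into traces of words of length four in `X`, `Y` and their adjoints; cyclicity
of the trace matches the words. Summed over a family, the correction term becomes the squared norm
of `∑ [X, Xᴴ]`. -/
lemma frobSq_lie_conjTranspose (X Y : Matrix (Fin n) (Fin n) ℂ) :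
    (frobSq ⁅X, Yᴴ⁆ : ℂ) = frobSq ⁅X, Y⁆ + Matrix.trace (⁅X, Xᴴ⁆ * ⁅Y, Yᴴ⁆) := by
  have c := fun A B C D : Matrix (Fin n) (Fin n) ℂ =>
    (show Matrix.trace (A * (B * (C * D))) = Matrix.trace (B * (C * (D * A))) by
      rw [Matrix.trace_mul_comm]; simp only [Matrix.mul_assoc])
  have e : ∀ M : Matrix (Fin n) (Fin n) ℂ, ((frobSq M : ℝ) : ℂ) = Matrix.trace (M * Mᴴ) :=
    fun M => coe_frobSq M
  rw [e, e]
  simp only [Ring.lie_def, Matrix.conjTranspose_sub, Matrix.conjTranspose_mul,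
    Matrix.conjTranspose_conjTranspose, mul_sub, sub_mul, Matrix.trace_sub, Matrix.mul_assoc]
  linear_combination -c Xᴴ X Yᴴ Y + c Yᴴ X Xᴴ Y + c Xᴴ X Y Yᴴ - c Y X Xᴴ Yᴴ + c Y X Yᴴ Xᴴ
    - c Yᴴ X Y Xᴴ

/-- The real and imaginary parts of the entries, as real matrices. -/
noncomputable def realTuple (B : Fin m → Matrix (Fin n) (Fin n) ℂ) :
    Fin (m + m) → Matrix (Fin n) (Fin n) ℝ :=
  Fin.append (fun r => (B r).map Complex.re) (fun r => (B r).map Complex.im)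

lemma parts_eq_map (B : Fin m → Matrix (Fin n) (Fin n) ℂ) (k : Fin (m + m)) :
    parts B k = (realTuple B k).map Complex.ofReal := by
  refine Fin.addCases (fun r => ?_) (fun r => ?_) k
  · ext i j
    apply Complex.ext <;> simp [parts, realTuple, realPart, conjMatrix] <;> ring
  · ext i j
    have h : (1 / (2 * Complex.I) : ℂ) = -Complex.I / 2 := by
      field_simp; simp
    apply Complex.ext <;>
      simp [parts, realTuple, imagPart, conjMatrix, -one_div, h, -Fin.natAdd_eq_addNat] <;> ring

lemma realTuple_transpose {B : Fin m → Matrix (Fin n) (Fin n) ℂ} (hB : ∀ r, (B r)ᵀ = -B r)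
    (k : Fin (m + m)) : (realTuple B k)ᵀ = -realTuple B k := by
  have h := fun r i j => congrFun (congrFun (hB r) i) j
  simp only [Matrix.transpose_apply, Matrix.neg_apply] at h
  refine Fin.addCases (fun r => ?_) (fun r => ?_) k <;> ext i j <;>
    simp [realTuple, h r i j, -Fin.natAdd_eq_addNat]

lemma sum_frobSq_realTuple (B : Fin m → Matrix (Fin n) (Fin n) ℂ) :
    ∑ k, frobSq (realTuple B k) = ∑ r, frobSq (B r) := by
  rw [Fin.sum_univ_add, ← Finset.sum_add_distrib]
  refine Finset.sum_congr rfl fun r _ => ?_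
  simp only [realTuple, Fin.append_left, Fin.append_right, frobSq, ← Finset.sum_add_distrib]
  refine Finset.sum_congr rfl fun i _ => Finset.sum_congr rfl fun j _ => ?_
  rw [Complex.sq_norm, Complex.normSq_apply]
  simp [sq]

lemma lie_matrix_neg {R : Type*} [Ring R] (X Y : Matrix (Fin n) (Fin n) R) :
    ⁅X, -Y⁆ = -⁅X, Y⁆ := by
  simp only [Ring.lie_def, mul_neg, neg_mul]
  abel

lemma lie_apply_re (X Y : Matrix (Fin n) (Fin n) ℂ) (i j : Fin n) :
    (⁅X, Y⁆ i j).re = (⁅X.map Complex.re, Y.map Complex.re⁆ i j)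
      - (⁅X.map Complex.im, Y.map Complex.im⁆ i j) := by
  simp [Ring.lie_def, Matrix.mul_apply, Complex.re_sum, Complex.mul_re, Finset.sum_sub_distrib]
  ring

lemma lie_apply_im (X Y : Matrix (Fin n) (Fin n) ℂ) (i j : Fin n) :
    (⁅X, Y⁆ i j).im = (⁅X.map Complex.re, Y.map Complex.im⁆ i j)
      + (⁅X.map Complex.im, Y.map Complex.re⁆ i j) := by
  simp [Ring.lie_def, Matrix.mul_apply, Complex.im_sum, Complex.mul_im, Finset.sum_add_distrib]
  ring

/-- Parallelogram law: conjugating `Y` flips the sign of its imaginary part, so the cross terms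
cancel in each entry. -/
lemma frobSq_lie_add_frobSq_lie_conj (X Y : Matrix (Fin n) (Fin n) ℂ) :
    frobSq ⁅X, Y⁆ + frobSq ⁅X, conjMatrix Y⁆ =
      2 * (frobSq ⁅X.map Complex.re, Y.map Complex.re⁆
        + frobSq ⁅X.map Complex.re, Y.map Complex.im⁆
        + (frobSq ⁅X.map Complex.im, Y.map Complex.re⁆
        + frobSq ⁅X.map Complex.im, Y.map Complex.im⁆)) := by
  have hr : (conjMatrix Y).map Complex.re = Y.map Complex.re := by ext; simp [conjMatrix]
  have hi : (conjMatrix Y).map Complex.im = -Y.map Complex.im := by ext; simp [conjMatrix]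
  simp only [frobSq, Finset.mul_sum, ← Finset.sum_add_distrib]
  refine Finset.sum_congr rfl fun i _ => Finset.sum_congr rfl fun j _ => ?_
  simp only [Complex.sq_norm, Complex.normSq_apply, lie_apply_re, lie_apply_im, hr, hi,
    lie_matrix_neg,
    Matrix.neg_apply, Real.norm_eq_abs, sq_abs]
  ring

lemma conjMatrix_eq_neg {Y : Matrix (Fin n) (Fin n) ℂ} (hY : Yᵀ = -Y) :
    conjMatrix Y = -Yᴴ := by
  rw [Matrix.conjTranspose, hY]
  ext; simp [conjMatrix]

/-- The commutators of complex skew-symmetric matrices and those of their real and imaginary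
parts. -/
lemma sum_frobSq_lie_realTuple {B : Fin m → Matrix (Fin n) (Fin n) ℂ}
    (hB : ∀ r, (B r)ᵀ = -B r) :
    ∑ j, ∑ k, frobSq ⁅realTuple B j, realTuple B k⁆ =
      ∑ r, ∑ s, frobSq ⁅B r, B s⁆ + 1 / 2 * frobSq (∑ r, ⁅B r, conjMatrix (B r)⁆) := by
  have h1 : ∑ r, ∑ s, frobSq ⁅B r, (B s)ᴴ⁆ =
      ∑ r, ∑ s, frobSq ⁅B r, B s⁆ + frobSq (∑ r, ⁅B r, (B r)ᴴ⁆) := by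
    have hZ : (∑ r, ⁅B r, (B r)ᴴ⁆)ᴴ = ∑ r, ⁅B r, (B r)ᴴ⁆ := by
      rw [Matrix.conjTranspose_sum]
      simp [Ring.lie_def]
    have e : ((frobSq (∑ r, ⁅B r, (B r)ᴴ⁆) : ℝ) : ℂ)
      = ∑ r, ∑ s, Matrix.trace (⁅B r, (B r)ᴴ⁆ * ⁅B s, (B s)ᴴ⁆) := by
      refine (coe_frobSq _).trans ?_
      rw [hZ, Finset.sum_mul_sum, Matrix.trace_sum]
      simp [Matrix.trace_sum]
    apply Complex.ofReal_injective
    push_cast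
    rw [e]
    simp only [frobSq_lie_conjTranspose, Finset.sum_add_distrib]
  have h2 : ∑ r, ⁅B r, conjMatrix (B r)⁆ = -∑ r, ⁅B r, (B r)ᴴ⁆ := by
    simp [conjMatrix_eq_neg (hB _), lie_matrix_neg]
  have h3 : ∑ r, ∑ s, (frobSq ⁅B r, B s⁆ + frobSq ⁅B r, conjMatrix (B s)⁆) =
      2 * ∑ j, ∑ k, frobSq ⁅realTuple B j, realTuple B k⁆ := by
    simp only [frobSq_lie_add_frobSq_lie_conj, Fin.sum_univ_add (a := m), realTuple,
      Fin.append_left, Fin.append_right, ← Finset.mul_sum, Finset.sum_add_distrib]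
  simp only [conjMatrix_eq_neg (hB _), lie_matrix_neg, frobSq_neg, Finset.sum_add_distrib, h1] at h3
  rw [h2, frobSq_neg]
  linarith

end Reduction

/-! ### The scalar inequality for the eigenvalues. -/

section Numbers

/-- Here `x` stands for the largest eigenvalue, `y` for another one, and `T` for the sum of squares
of all but the largest. The bound is proportional to `y ^ 2`, so that it can be summed over `y`. -/
lemma max_sq_add_sub_le {x y T : ℝ} (hy : 0 < y) (hT : x ^ 2 + T = 1 / 2)
    (hyT : y ^ 2 ≤ T) :
    max ((x + y) ^ 2 - 2 / 3) 0 ≤ y ^ 2 / (3 * T) ∧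
      (max ((x + y) ^ 2 - 2 / 3) 0 = y ^ 2 / (3 * T) → x = 1 / 2 ∧ y = 1 / 2) := by
  have hT0 : 0 < T := lt_of_lt_of_le (by positivity) hyT
  have key : 3 * T * ((x + y) ^ 2 - 2 / 3)
      = y ^ 2 + (y ^ 2 - T) / 2 - 3 * (x * y - T) ^ 2 := by
    have hx2 : x ^ 2 = 1 / 2 - T := by linarith
    linear_combination (3 * T + 3 * y ^ 2) * hx2
  have hpos : 0 < y ^ 2 / (3 * T) := by positivity
  refine ⟨max_le ?_ hpos.le, fun h => ?_⟩
  · rw [le_div_iff₀ (by positivity)]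
    nlinarith [sq_nonneg (x * y - T)]
  · rcases max_choice ((x + y) ^ 2 - 2 / 3) 0 with h' | h'
    · rw [h', eq_div_iff (by positivity)] at h
      have h1 : y ^ 2 = T := by nlinarith [sq_nonneg (x * y - T)]
      have h2 : x * y - T = 0 := by
        have : (x * y - T) ^ 2 = 0 := by nlinarith [sq_nonneg (x * y - T)]
        exact pow_eq_zero_iff (two_ne_zero) |>.1 this
      have h3 : x = y := by
        have : y * (x - y) = 0 := by linear_combination h2 - h1
        rcases mul_eq_zero.1 this with h | h <;> linarith
      have h4 : (2 * y - 1) * (2 * y + 1) = 0 := by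
        subst h3; linear_combination 2 * hT + 2 * h1
      rcases mul_eq_zero.1 h4 with h | h
      · constructor <;> linarith
      · linarith
    · rw [h'] at h
      exact absurd h hpos.ne

/-- Only pairs containing the maximum `l i` can contribute. Any other pair satisfies `l a ^ 2 + l b
^ 2 ≤ 2 * l i ^ 2` and `l a ^ 2 + l b ^ 2 + l i ^ 2 ≤ 1 / 2`, hence `(l a + l b) ^ 2 ≤ 2 / 3`. The
remaining terms are bounded by shares `l b ^ 2 / (3 * T)` that add up to `1 / 3`, and each pair is
counted in both orders. -/
lemma sum_max_sq_add_sub_le {ι : Type*} [DecidableEq ι] (s : Finset ι) (l : ι → ℝ)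
    (hpos : ∀ a ∈ s, 0 < l a) (hs : ∑ a ∈ s, l a ^ 2 = 1 / 2) :
    ∑ a ∈ s, ∑ b ∈ s.erase a, max ((l a + l b) ^ 2 - 2 / 3) 0 ≤ 2 / 3 ∧
      (∑ a ∈ s, ∑ b ∈ s.erase a, max ((l a + l b) ^ 2 - 2 / 3) 0 = 2 / 3 →
        ∀ a ∈ s, l a = 1 / 2) := by
  have hne : s.Nonempty := by
    rw [Finset.nonempty_iff_ne_empty]; rintro rfl; norm_num at hs
  obtain ⟨i, hi, hmax⟩ := s.exists_max_image l hne
  set T := ∑ a ∈ s.erase i, l a ^ 2 with hTdef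
  have hT : l i ^ 2 + T = 1 / 2 := by rw [hTdef, Finset.add_sum_erase s (fun a => l a ^ 2) hi, hs]
  have hyT : ∀ b ∈ s.erase i, l b ^ 2 ≤ T := fun b hb =>
    Finset.single_le_sum (f := fun b => l b ^ 2) (fun _ _ => sq_nonneg _) hb
  have hmem : ∀ b ∈ s.erase i, b ∈ s := fun b hb => Finset.mem_of_mem_erase hb
  have hzero : ∀ a ∈ s.erase i, ∑ b ∈ s.erase a, max ((l a + l b) ^ 2 - 2 / 3) 0
      = max ((l i + l a) ^ 2 - 2 / 3) 0 := by
    intro a ha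
    rw [Finset.sum_eq_single_of_mem i (Finset.mem_erase.2 ⟨(Finset.ne_of_mem_erase ha).symm, hi⟩),
      add_comm]
    intro b hb hbi
    have hbs := Finset.mem_of_mem_erase hb
    have h1 : l a ^ 2 + l b ^ 2 ≤ T := by
      rw [← Finset.sum_pair (f := fun a => l a ^ 2) (Finset.ne_of_mem_erase hb).symm]
      refine Finset.sum_le_sum_of_subset_of_nonneg ?_ fun _ _ _ => sq_nonneg _
      intro x hx
      rcases Finset.mem_insert.1 hx with rfl | hx
      · exact ha
      · rw [Finset.mem_singleton.1 hx]; exact Finset.mem_erase.2 ⟨hbi, hbs⟩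
    refine max_eq_right ?_
    nlinarith [hmax a (hmem a ha), hmax b hbs, hpos a (hmem a ha), hpos b hbs,
      sq_nonneg (l a - l b)]
  have htot : ∑ a ∈ s, ∑ b ∈ s.erase a, max ((l a + l b) ^ 2 - 2 / 3) 0
      = 2 * ∑ b ∈ s.erase i, max ((l i + l b) ^ 2 - 2 / 3) 0 := by
    rw [← Finset.add_sum_erase s _ hi, Finset.sum_congr rfl hzero]
    ring
  rw [htot]
  rcases (s.erase i).eq_empty_or_nonempty with he | ⟨c, hc⟩
  · rw [he]; norm_num
  have hT0 : 0 < T := lt_of_lt_of_le (pow_pos (hpos c (hmem c hc)) 2) (hyT c hc)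
  have hone : ∑ b ∈ s.erase i, l b ^ 2 / (3 * T) = 1 / 3 := by
    rw [← Finset.sum_div, ← hTdef]; field_simp
  have hb := fun b (hb : b ∈ s.erase i) =>
    max_sq_add_sub_le (hpos b (hmem b hb)) hT (hyT b hb)
  have hle := Finset.sum_le_sum fun b hb' => (hb b hb').1
  refine ⟨by linarith, fun h => ?_⟩
  have heq := (Finset.sum_eq_sum_iff_of_le fun b hb' => (hb b hb').1).1 (by linarith)
  intro a ha
  by_cases hai : a = i
  · subst hai; exact ((hb c hc).2 (heq c hc)).1
  · have ha' := Finset.mem_erase.2 ⟨hai, ha⟩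
    exact ((hb a ha').2 (heq a ha')).2

/-- For a pair of opposite signs `(θ a + θ b) ^ 2` is at most the larger square, hence at most `1 /
2 < 2 / 3`. The positive and the negative values therefore decouple, each contributing at most `2 /
3`. -/
lemma sum_max_sq_add_sub_le_of_balanced {ι : Type*} [Fintype ι] [DecidableEq ι] (θ : ι → ℝ)
    (hp : ∑ a with 0 < θ a, θ a ^ 2 = 1 / 2) (hn : ∑ a with θ a < 0, θ a ^ 2 = 1 / 2) :
    ∑ a, ∑ b ∈ Finset.univ.erase a, max ((θ a + θ b) ^ 2 - 2 / 3) 0 ≤ 4 / 3 ∧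
      (∑ a, ∑ b ∈ Finset.univ.erase a, max ((θ a + θ b) ^ 2 - 2 / 3) 0 = 4 / 3 →
        ∀ a, θ a = 0 ∨ θ a = 1 / 2 ∨ θ a = -1 / 2) := by
  set P := Finset.univ.filter fun a => 0 < θ a with hP
  set M := Finset.univ.filter fun a => θ a < 0 with hM
  have hsq : ∀ a, θ a ^ 2 ≤ 1 / 2 := by
    intro a
    rcases lt_trichotomy (θ a) 0 with h | h | h
    · rw [← hn]
      exact Finset.single_le_sum (f := fun a => θ a ^ 2) (fun _ _ => sq_nonneg _) (by simpa [hM])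
    · rw [h]; norm_num
    · rw [← hp]
      exact Finset.single_le_sum (f := fun a => θ a ^ 2) (fun _ _ => sq_nonneg _) (by simpa [hP])
  have hzero : ∀ a b, θ a * θ b ≤ 0 → max ((θ a + θ b) ^ 2 - 2 / 3) 0 = 0 := by
    intro a b hab
    refine max_eq_right ?_
    have ha := hsq a
    have hb := hsq b
    rcases le_total (θ a ^ 2) (θ b ^ 2) with h | h
    · have : (θ a + θ b) ^ 2 ≤ θ b ^ 2 := by
        have h1 := sq_le_sq.1 h
        have h2 : θ a ^ 2 ≤ - (θ a * θ b) := by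
          rw [← sq_abs, ← abs_of_nonpos hab, abs_mul, sq]
          exact mul_le_mul_of_nonneg_left h1 (abs_nonneg _)
        nlinarith
      linarith
    · have : (θ a + θ b) ^ 2 ≤ θ a ^ 2 := by
        have h1 := sq_le_sq.1 h
        have h2 : θ b ^ 2 ≤ - (θ a * θ b) := by
          rw [← sq_abs, ← abs_of_nonpos hab, abs_mul, sq]
          exact mul_le_mul_of_nonneg_right h1 (abs_nonneg _)
        nlinarith
      linarith
  have hsplit : ∀ a, ∑ b ∈ Finset.univ.erase a, max ((θ a + θ b) ^ 2 - 2 / 3) 0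
      = (if 0 < θ a then ∑ b ∈ P.erase a, max ((θ a + θ b) ^ 2 - 2 / 3) 0 else 0)
        + (if θ a < 0 then ∑ b ∈ M.erase a, max ((θ a + θ b) ^ 2 - 2 / 3) 0 else 0) := by
    intro a
    rcases lt_trichotomy (θ a) 0 with h | h | h
    · rw [if_neg h.not_gt, if_pos h, zero_add]
      symm
      refine Finset.sum_subset (Finset.erase_subset_erase _ (Finset.subset_univ _)) ?_
      intro b hb hb'
      refine hzero a b ?_
      have : ¬ θ b < 0 := fun hlt => hb' (Finset.mem_erase.2
        ⟨Finset.ne_of_mem_erase hb, by simpa [hM] using hlt⟩)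
      nlinarith
    · rw [if_neg (by linarith), if_neg (by linarith), zero_add]
      exact Finset.sum_eq_zero fun b _ => hzero a b (by rw [h]; simp)
    · rw [if_pos h, if_neg h.not_gt, add_zero]
      symm
      refine Finset.sum_subset (Finset.erase_subset_erase _ (Finset.subset_univ _)) ?_
      intro b hb hb'
      refine hzero a b ?_
      have : ¬ 0 < θ b := fun hlt => hb' (Finset.mem_erase.2
        ⟨Finset.ne_of_mem_erase hb, by simpa [hP] using hlt⟩)
      nlinarith
  rw [Finset.sum_congr rfl fun a _ => hsplit a, Finset.sum_add_distrib, ← Finset.sum_filter,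
    ← Finset.sum_filter, ← hP, ← hM]
  obtain ⟨p1, p2⟩ := sum_max_sq_add_sub_le P θ (fun a ha => by simpa [hP] using ha) hp
  obtain ⟨m1, m2⟩ := sum_max_sq_add_sub_le M (fun a => -θ a)
    (fun a ha => by simpa [hM] using ha) (by simpa using hn)
  have hneg : ∀ a b, (-θ a + -θ b) ^ 2 = (θ a + θ b) ^ 2 := fun a b => by ring
  simp only [hneg] at m1 m2
  refine ⟨by linarith, fun h a => ?_⟩
  rcases lt_trichotomy (θ a) 0 with ha | ha | ha
  · have := m2 (by linarith) a (by simpa [hM])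
    right; right; linarith
  · exact Or.inl ha
  · exact Or.inr (Or.inl (p2 (by linarith) a (by simpa [hP])))

end Numbers

/-! ### Spectral theory of a real skew-symmetric matrix, and Bessel's inequality. -/

section Spectral
variable {n : ℕ}

/-- A real matrix, regarded as a complex one. -/
noncomputable abbrev toComplex (M : Matrix (Fin n) (Fin n) ℝ) : Matrix (Fin n) (Fin n) ℂ :=
  M.map Complex.ofReal

lemma toComplex_mul (M N : Matrix (Fin n) (Fin n) ℝ) :
    toComplex (M * N) = toComplex M * toComplex N := Matrix.map_mul (f := Complex.ofRealHom)

lemma toComplex_sub (M N : Matrix (Fin n) (Fin n) ℝ) :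
    toComplex (M - N) = toComplex M - toComplex N := by ext; simp

lemma toComplex_smul (c : ℝ) (M : Matrix (Fin n) (Fin n) ℝ) :
    toComplex (c • M) = (c : ℂ) • toComplex M := by ext; simp

lemma toComplex_transpose {Q : Matrix (Fin n) (Fin n) ℝ} (hQ : Qᵀ = -Q) :
    (toComplex Q)ᵀ = -toComplex Q := by
  rw [toComplex, ← Matrix.transpose_map, hQ]; ext; simp

lemma frobSq_toComplex (M : Matrix (Fin n) (Fin n) ℝ) : frobSq (toComplex M) = frobSq M := by
  simp [frobSq]

lemma toComplex_injective : Function.Injective (toComplex (n := n)) :=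
  Matrix.map_injective Complex.ofReal_injective

/-- A real skew-symmetric matrix has an orthonormal basis of eigenvectors over `ℂ`, with purely
imaginary eigenvalues. -/
lemma exists_unitary_mul_diagonal {Q : Matrix (Fin n) (Fin n) ℝ} (hQ : Qᵀ = -Q) :
    ∃ (U : Matrix (Fin n) (Fin n) ℂ) (θ : Fin n → ℝ), Uᴴ * U = 1 ∧ U * Uᴴ = 1 ∧
      toComplex Q * U = U * Matrix.diagonal fun a => -Complex.I * θ a := by
  have hH : (Complex.I • toComplex Q).IsHermitian := by
    ext i j
    have := congrFun (congrFun hQ i) j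
    simp only [Matrix.transpose_apply, Matrix.neg_apply] at this
    simp [this]
  have hU := hH.eigenvectorUnitary.2
  refine ⟨hH.eigenvectorUnitary, hH.eigenvalues, Matrix.mem_unitaryGroup_iff'.1 hU,
    Matrix.mem_unitaryGroup_iff.1 hU, ?_⟩
  ext i a
  have h := congrFun (hH.eigenvectorUnitary_mulVec a) i
  have h1 := congrFun (hH.mulVec_eigenvectorBasis a) i
  rw [Matrix.mul_diagonal]
  simp only [Matrix.smul_mulVec, Pi.smul_apply, smul_eq_mul, Complex.real_smul] at h1
  have h2 : (toComplex Q * (hH.eigenvectorUnitary : Matrix (Fin n) (Fin n) ℂ)) i a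
      = (toComplex Q).mulVec (hH.eigenvectorBasis a).ofLp i := by
    simp [Matrix.mul_apply, Matrix.mulVec, dotProduct, Matrix.IsHermitian.eigenvectorUnitary_apply]
  rw [h2, Matrix.IsHermitian.eigenvectorUnitary_apply]
  linear_combination -Complex.I * h1 + (toComplex Q).mulVec (hH.eigenvectorBasis a).ofLp i *
    Complex.I_sq

/-- The matrix of coefficients of `X` with respect to the `u_a u_bᵗ`, for `u_a` the columns of
`U`. -/
noncomputable def coeffs (U : Matrix (Fin n) (Fin n) ℂ) (X : Matrix (Fin n) (Fin n) ℝ) :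
    Matrix (Fin n) (Fin n) ℂ :=
  Uᴴ * toComplex X * Uᴴᵀ

lemma coeffs_sub (U : Matrix (Fin n) (Fin n) ℂ) (X Y : Matrix (Fin n) (Fin n) ℝ) :
    coeffs U (X - Y) = coeffs U X - coeffs U Y := by
  rw [coeffs, toComplex_sub, mul_sub, sub_mul]; rfl

lemma coeffs_smul (U : Matrix (Fin n) (Fin n) ℂ) (c : ℝ) (X : Matrix (Fin n) (Fin n) ℝ) :
    coeffs U (c • X) = (c : ℂ) • coeffs U X := by
  rw [coeffs, toComplex_smul, Matrix.mul_smul, Matrix.smul_mul]; rfl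

lemma coeffs_transpose (U : Matrix (Fin n) (Fin n) ℂ) {X : Matrix (Fin n) (Fin n) ℝ}
    (hX : Xᵀ = -X) : (coeffs U X)ᵀ = -coeffs U X := by
  rw [coeffs, Matrix.transpose_mul, Matrix.transpose_mul, Matrix.transpose_transpose,
    toComplex_transpose hX]
  simp [Matrix.mul_assoc]

lemma frobSq_coeffs {U : Matrix (Fin n) (Fin n) ℂ} (hU' : U * Uᴴ = 1)
    (X : Matrix (Fin n) (Fin n) ℝ) : frobSq (coeffs U X) = frobSq X := by
  rw [coeffs, frobSq_unitary_mul_mul, frobSq_toComplex]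
  · rwa [Matrix.conjTranspose_conjTranspose]
  · rw [Matrix.conjTranspose_transpose_eq_transpose_conjTranspose,
      Matrix.conjTranspose_conjTranspose, ← Matrix.transpose_mul, hU', Matrix.transpose_one]

lemma coeffs_injective {U : Matrix (Fin n) (Fin n) ℂ} (hU' : U * Uᴴ = 1)
    {X Y : Matrix (Fin n) (Fin n) ℝ} (h : coeffs U X = coeffs U Y) : X = Y := by
  rw [← sub_eq_zero]
  apply frobSq_eq_zero
  rw [← frobSq_coeffs hU', coeffs_sub, h, sub_self, frobSq_zero]

lemma conjTranspose_mul_toComplex {Q : Matrix (Fin n) (Fin n) ℝ} {U D : Matrix (Fin n) (Fin n) ℂ}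
    (hU : Uᴴ * U = 1) (hU' : U * Uᴴ = 1) (h : toComplex Q * U = U * D) :
    Uᴴ * toComplex Q = D * Uᴴ := by
  calc Uᴴ * toComplex Q = Uᴴ * (toComplex Q * U) * Uᴴ := by
        rw [Matrix.mul_assoc, Matrix.mul_assoc, hU', Matrix.mul_one]
    _ = D * Uᴴ := by rw [h, ← Matrix.mul_assoc, hU, Matrix.one_mul]

lemma coeffs_mul_left {Q : Matrix (Fin n) (Fin n) ℝ} {U : Matrix (Fin n) (Fin n) ℂ}
    {θ : Fin n → ℝ} (hU : Uᴴ * U = 1) (hU' : U * Uᴴ = 1)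
    (h : toComplex Q * U = U * Matrix.diagonal fun a => -Complex.I * θ a)
    (X : Matrix (Fin n) (Fin n) ℝ) (a b : Fin n) :
    coeffs U (Q * X) a b = -Complex.I * θ a * coeffs U X a b := by
  rw [coeffs, toComplex_mul, ← Matrix.mul_assoc, conjTranspose_mul_toComplex hU hU' h,
    Matrix.mul_assoc, Matrix.mul_assoc, Matrix.diagonal_mul, ← Matrix.mul_assoc, coeffs]

lemma coeffs_mul_right {Q : Matrix (Fin n) (Fin n) ℝ} (hQ : Qᵀ = -Q)
    {U : Matrix (Fin n) (Fin n) ℂ}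
    {θ : Fin n → ℝ} (hU : Uᴴ * U = 1) (hU' : U * Uᴴ = 1)
    (h : toComplex Q * U = U * Matrix.diagonal fun a => -Complex.I * θ a)
    (X : Matrix (Fin n) (Fin n) ℝ) (a b : Fin n) :
    coeffs U (X * Q) a b = Complex.I * θ b * coeffs U X a b := by
  have hQc := toComplex_transpose hQ
  have h1 := congrArg Matrix.transpose (conjTranspose_mul_toComplex hU hU' h)
  rw [Matrix.transpose_mul, Matrix.transpose_mul, hQc, Matrix.diagonal_transpose,
    Matrix.neg_mul, neg_eq_iff_eq_neg] at h1
  rw [coeffs, toComplex_mul, ← Matrix.mul_assoc, Matrix.mul_assoc _ (toComplex Q), h1,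
    Matrix.mul_neg, ← Matrix.mul_assoc, Matrix.neg_apply, Matrix.mul_diagonal, coeffs]
  ring

/-- The spectrum is symmetric about zero. Skewness of `Q` gives `M a b * (θ a + θ b) = 0` for the
unitary symmetric matrix `M = Uᵀ * U`, so the doubly stochastic matrix `‖M a b‖ ^ 2` transports the
`θ a` to the `-θ b`. This avoids matching eigenvalues with multiplicity. -/
lemma sum_comp_eq_sum_comp_neg {Q : Matrix (Fin n) (Fin n) ℝ} (hQ : Qᵀ = -Q)
    {U : Matrix (Fin n) (Fin n) ℂ}
    {θ : Fin n → ℝ} (hU : Uᴴ * U = 1) (hU' : U * Uᴴ = 1)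
    (h : toComplex Q * U = U * Matrix.diagonal fun a => -Complex.I * θ a) (f : ℝ → ℝ) :
    ∑ a, f (θ a) = ∑ a, f (-θ a) := by
  have hQc := toComplex_transpose hQ
  set M := Uᵀ * U with hM
  have hMs : Mᵀ = M := by rw [hM, Matrix.transpose_mul, Matrix.transpose_transpose]
  have hMM : M * Mᴴ = 1 := by
    rw [hM, Matrix.conjTranspose_mul, Matrix.mul_assoc, ← Matrix.mul_assoc U, hU', Matrix.one_mul,
      Matrix.conjTranspose_transpose_eq_transpose_conjTranspose, ← Matrix.transpose_mul, hU,
      Matrix.transpose_one]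
  have h1 : Uᵀ * toComplex Q * U = M * Matrix.diagonal fun a => -Complex.I * θ a := by
    rw [Matrix.mul_assoc, h, ← Matrix.mul_assoc]
  have h2 := congrArg Matrix.transpose h1
  rw [Matrix.transpose_mul, Matrix.transpose_mul, Matrix.transpose_transpose, hQc,
    Matrix.transpose_mul, hMs, Matrix.diagonal_transpose, Matrix.neg_mul, Matrix.mul_neg,
    ← Matrix.mul_assoc, h1] at h2
  have hab : ∀ a b, M a b ≠ 0 → θ a = -θ b := by
    intro a b hne
    have h3 := congrFun (congrFun h2 a) b
    rw [Matrix.neg_apply, Matrix.mul_diagonal, Matrix.diagonal_mul] at h3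
    have h4 : M a b * (Complex.I * (θ a + θ b)) = 0 := by linear_combination h3
    have h5 := (mul_eq_zero.1 ((mul_eq_zero.1 h4).resolve_left hne)).resolve_left Complex.I_ne_zero
    have h6 : θ a + θ b = 0 := by exact_mod_cast h5
    linarith
  have hrow : ∀ a, ∑ b, ‖M a b‖ ^ 2 = 1 := by
    intro a
    have h3 := congrFun (congrFun hMM a) a
    rw [Matrix.mul_apply, Matrix.one_apply_eq] at h3
    have : ((∑ b, ‖M a b‖ ^ 2 : ℝ) : ℂ) = 1 := by
      rw [← h3]; push_cast
      exact Finset.sum_congr rfl fun b _ => by simp [Complex.mul_conj, Complex.normSq_eq_norm_sq]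
    exact_mod_cast this
  have hcol : ∀ b, ∑ a, ‖M a b‖ ^ 2 = 1 := by
    intro b
    rw [← hrow b]
    exact Finset.sum_congr rfl fun a _ => by rw [← hMs, Matrix.transpose_apply, hMs]
  calc ∑ a, f (θ a) = ∑ a, ∑ b, ‖M a b‖ ^ 2 * f (θ a) := by
        simp only [← Finset.sum_mul, hrow, one_mul]
    _ = ∑ a, ∑ b, ‖M a b‖ ^ 2 * f (-θ b) := by
        refine Finset.sum_congr rfl fun a _ => Finset.sum_congr rfl fun b _ => ?_
        by_cases hne : M a b = 0
        · simp [hne]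
        · rw [hab a b hne]
    _ = ∑ b, f (-θ b) := by
        rw [Finset.sum_comm]
        simp only [← Finset.sum_mul, hcol, one_mul]

lemma sum_sq_eq_frobSq {Q : Matrix (Fin n) (Fin n) ℝ} {U : Matrix (Fin n) (Fin n) ℂ}
    {θ : Fin n → ℝ} (hU : Uᴴ * U = 1) (hU' : U * Uᴴ = 1)
    (h : toComplex Q * U = U * Matrix.diagonal fun a => -Complex.I * θ a) :
    ∑ a, θ a ^ 2 = frobSq Q := by
  have h1 : Uᴴ * toComplex Q * U = Matrix.diagonal fun a => -Complex.I * θ a := by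
    rw [Matrix.mul_assoc, h, ← Matrix.mul_assoc, hU, Matrix.one_mul]
  rw [← frobSq_toComplex, ← frobSq_unitary_mul_mul (U := Uᴴ) (V := U) (by simpa using hU') hU', h1]
  simp only [frobSq]
  refine Finset.sum_congr rfl fun a _ => ?_
  rw [Finset.sum_eq_single a]
  · simp
  · intro b _ hb; simp [Matrix.diagonal_apply_ne _ hb.symm]
  · simp

lemma eigenvalues_balanced {Q : Matrix (Fin n) (Fin n) ℝ} (hQ : Qᵀ = -Q) (hQ1 : frobSq Q = 1)
    {U : Matrix (Fin n) (Fin n) ℂ}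
    {θ : Fin n → ℝ} (hU : Uᴴ * U = 1) (hU' : U * Uᴴ = 1)
    (h : toComplex Q * U = U * Matrix.diagonal fun a => -Complex.I * θ a) :
    ∑ a with 0 < θ a, θ a ^ 2 = 1 / 2 ∧ ∑ a with θ a < 0, θ a ^ 2 = 1 / 2 := by
  have h1 := sum_comp_eq_sum_comp_neg hQ hU hU' h fun t => if 0 < t then t ^ 2 else 0
  simp only [Left.neg_pos_iff, neg_sq] at h1
  have h2 := sum_sq_eq_frobSq hU hU' h
  have h3 : ∑ a, θ a ^ 2 = ∑ a, (if 0 < θ a then θ a ^ 2 else 0)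
      + ∑ a, (if θ a < 0 then θ a ^ 2 else 0) := by
    rw [← Finset.sum_add_distrib]
    refine Finset.sum_congr rfl fun a _ => ?_
    rcases lt_trichotomy (θ a) 0 with h | h | h
    · rw [if_neg h.not_gt, if_pos h, zero_add]
    · simp [h]
    · rw [if_neg h.not_gt, if_pos h, add_zero]
  rw [Finset.sum_filter, Finset.sum_filter]
  constructor <;> linarith

/-- Bessel's inequality for the coefficients of an orthonormal family of skew-symmetric
matrices. -/
lemma sum_norm_sq_coeffs_le {ι : Type*} [DecidableEq ι] {U : Matrix (Fin n) (Fin n) ℂ}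
    (hU : Uᴴ * U = 1) (S : Finset ι) {X : ι → Matrix (Fin n) (Fin n) ℝ}
    (hX : ∀ s ∈ S, (X s)ᵀ = -X s)
    (horth : ∀ s ∈ S, ∀ t ∈ S, ∑ i, ∑ j, X s i j * X t i j = if s = t then 1 else 0)
    {a b : Fin n} (hab : a ≠ b) :
    ∑ s ∈ S, ‖coeffs U (X s) a b‖ ^ 2 ≤ 1 / 2 := by
  have hcol : ∀ a b, ∑ i, U i a * conj (U i b) = if a = b then 1 else 0 := by
    intro a b
    have := congrFun (congrFun hU b) a
    rw [Matrix.mul_apply, Matrix.one_apply] at this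
    simp only [Matrix.conjTranspose_apply, eq_comm (a := b)] at this
    rw [← this]
    exact Finset.sum_congr rfl fun i _ => mul_comm _ _
  let v : S → EuclideanSpace ℂ (Fin n × Fin n) := fun s =>
    WithLp.toLp 2 fun p => (X s p.1 p.2 : ℂ)
  -- This is the antisymmetrization of `u_a u_bᵗ`. Pairing with it loses nothing on skew matrices
  -- and halves the squared norm, whence the bound `1 / 2` instead of `1`.
  let w : EuclideanSpace ℂ (Fin n × Fin n) :=
    WithLp.toLp 2 fun p => (1 / 2 : ℂ) * (U p.1 a * U p.2 b - U p.1 b * U p.2 a)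
  have hv : Orthonormal ℂ v := by
    rw [orthonormal_iff_ite]
    intro s t
    have := horth s s.2 t t.2
    rw [PiLp.inner_apply, Fintype.sum_prod_type]
    simp only [v, RCLike.inner_apply, Complex.conj_ofReal, Subtype.ext_iff]
    have h2 : ((∑ i, ∑ j, X s i j * X t i j : ℝ) : ℂ) = if (s : ι) = t then 1 else 0 := by
      rw [this]; split_ifs <;> simp
    rw [← h2]; push_cast
    exact Finset.sum_congr rfl fun i _ => Finset.sum_congr rfl fun j _ => mul_comm _ _
  have hw : ‖w‖ ^ 2 = 1 / 2 := by
    rw [EuclideanSpace.norm_sq_eq, Fintype.sum_prod_type]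
    apply Complex.ofReal_injective
    have e : ∀ z : ℂ, ((‖z‖ ^ 2 : ℝ) : ℂ) = z * conj z := fun z => by
      rw [Complex.mul_conj, Complex.normSq_eq_norm_sq]
    simp only [Complex.ofReal_sum, e, w]
    have h2 : ∀ i j, (1 / 2 : ℂ) * (U i a * U j b - U i b * U j a) *
        conj ((1 / 2 : ℂ) * (U i a * U j b - U i b * U j a)) =
        1 / 4 * ((U i a * conj (U i a)) * (U j b * conj (U j b))
          - (U i a * conj (U i b)) * (U j b * conj (U j a))
          - (U i b * conj (U i a)) * (U j a * conj (U j b))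
          + (U i b * conj (U i b)) * (U j a * conj (U j a))) := by
      intro i j
      simp only [map_mul, map_sub, map_div₀, map_one, Complex.conj_ofNat]
      ring
    simp only [h2, ← Finset.mul_sum, Finset.sum_add_distrib, Finset.sum_sub_distrib,
      ← Finset.sum_mul, hcol, if_neg hab, if_neg hab.symm, if_true]
    norm_num
  have hin : ∀ s : S, ‖coeffs U (X s) a b‖ = ‖inner ℂ (v s) w‖ := by
    intro s
    rw [← Complex.norm_conj]
    congr 1
    rw [PiLp.inner_apply, Fintype.sum_prod_type]
    have hsk : ∀ i j, X s j i = -X s i j := fun i j => congrFun (congrFun (hX s s.2) i) j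
    have h1 : conj (coeffs U (X s) a b) = ∑ i, ∑ j, U i a * X s i j * U j b := by
      simp only [coeffs, Matrix.mul_apply, Matrix.conjTranspose_apply, Matrix.transpose_apply,
        map_sum, map_mul, Finset.sum_mul, Matrix.map_apply, Complex.conj_ofReal,
        RCLike.star_def, Complex.conj_conj]
      exact Finset.sum_comm
    have h2 : ∑ i, ∑ j, U i b * X s i j * U j a = -∑ i, ∑ j, U i a * X s i j * U j b := by
      rw [Finset.sum_comm, ← Finset.sum_neg_distrib]
      refine Finset.sum_congr rfl fun i _ => ?_
      rw [← Finset.sum_neg_distrib]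
      refine Finset.sum_congr rfl fun j _ => ?_
      rw [hsk i j]; push_cast; ring
    have h3 : ∀ i j, inner ℂ ((v s).ofLp (i, j)) (w.ofLp (i, j)) =
        1 / 2 * (U i a * X s i j * U j b) - 1 / 2 * (U i b * X s i j * U j a) := by
      intro i j
      simp only [v, w, RCLike.inner_apply, Complex.conj_ofReal]
      ring
    simp only [h3, Finset.sum_sub_distrib, ← Finset.mul_sum, h2, h1]
    ring
  calc ∑ s ∈ S, ‖coeffs U (X s) a b‖ ^ 2 = ∑ s : S, ‖inner ℂ (v s) w‖ ^ 2 := by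
        rw [← Finset.sum_coe_sort]
        exact Finset.sum_congr rfl fun s _ => by rw [hin s]
    _ ≤ ‖w‖ ^ 2 := hv.sum_inner_products_le w
    _ = 1 / 2 := hw

end Spectral

/-! ### Commutators of one matrix with an orthonormal family. -/

section Key
variable {n : ℕ}

/-- The commutators of a unit skew-symmetric matrix with an orthonormal family of skew-symmetric
matrices. -/
lemma sum_frobSq_lie_sub_le {ι : Type*} [DecidableEq ι] {Q : Matrix (Fin n) (Fin n) ℝ}
    (hQ : Qᵀ = -Q) (hQ1 : frobSq Q = 1) (S : Finset ι) {X : ι → Matrix (Fin n) (Fin n) ℝ}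
    (hX : ∀ s ∈ S, (X s)ᵀ = -X s)
    (horth : ∀ s ∈ S, ∀ t ∈ S, ∑ i, ∑ j, X s i j * X t i j = if s = t then 1 else 0) :
    ∑ s ∈ S, (frobSq ⁅Q, X s⁆ - 2 / 3) ≤ 2 / 3 ∧
      (∑ s ∈ S, (frobSq ⁅Q, X s⁆ - 2 / 3) = 2 / 3 → S.card = 2 ∧
        ∀ s ∈ S, frobSq ⁅Q, X s⁆ = 1 ∧ Q * X s * Q = (1 / 4 : ℝ) • X s ∧
          Q * (Q * X s) = (-1 / 4 : ℝ) • X s) := by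
  obtain ⟨U, θ, hU, hU', h⟩ := exists_unitary_mul_diagonal hQ
  obtain ⟨hp, hn⟩ := eigenvalues_balanced hQ hQ1 hU hU' h
  obtain ⟨hle, heq⟩ := sum_max_sq_add_sub_le_of_balanced θ hp hn
  -- Total weight of the family at position `(a, b)`: at most `1 / 2` by Bessel, and zero on the
  -- diagonal because the coefficient matrices are skew.
  set p : Fin n → Fin n → ℝ := fun a b => ∑ s ∈ S, ‖coeffs U (X s) a b‖ ^ 2 with hpdef
  have hp0 : ∀ a b, 0 ≤ p a b := fun a b => Finset.sum_nonneg fun _ _ => sq_nonneg _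
  have hp1 : ∀ a b, a ≠ b → p a b ≤ 1 / 2 := fun a b hab =>
    sum_norm_sq_coeffs_le hU S hX horth hab
  have hdiag : ∀ s ∈ S, ∀ a, coeffs U (X s) a a = 0 := by
    intro s hs a
    have h1 := congrFun (congrFun (coeffs_transpose U (hX s hs)) a) a
    rw [Matrix.transpose_apply, Matrix.neg_apply] at h1
    exact self_eq_neg.1 h1
  have hpd : ∀ a, p a a = 0 := fun a => Finset.sum_eq_zero fun s hs => by
    rw [hdiag s hs a]; simp
  have hlie : ∀ s, frobSq ⁅Q, X s⁆ = ∑ a, ∑ b, (θ a + θ b) ^ 2 * ‖coeffs U (X s) a b‖ ^ 2 := by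
    intro s
    rw [← frobSq_coeffs hU', Ring.lie_def, coeffs_sub]
    refine Finset.sum_congr rfl fun a _ => Finset.sum_congr rfl fun b _ => ?_
    rw [Matrix.sub_apply, coeffs_mul_left hU hU' h, coeffs_mul_right hQ hU hU' h,
      show -Complex.I * θ a * coeffs U (X s) a b - Complex.I * θ b * coeffs U (X s) a b
        = -Complex.I * ((θ a + θ b : ℝ) : ℂ) * coeffs U (X s) a b by push_cast; ring]
    rw [norm_mul, norm_mul, norm_neg, Complex.norm_I, one_mul, Complex.norm_real, mul_pow,
      Real.norm_eq_abs, sq_abs]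
  have hone : ∀ s ∈ S, ∑ a, ∑ b, ‖coeffs U (X s) a b‖ ^ 2 = 1 := by
    intro s hs
    have h1 := horth s hs s hs
    rw [if_pos rfl] at h1
    rw [← h1]
    refine (frobSq_coeffs hU' (X s)).trans ?_
    simp [frobSq, sq]
  have hsum : ∑ s ∈ S, (frobSq ⁅Q, X s⁆ - 2 / 3)
      = ∑ a, ∑ b, p a b * ((θ a + θ b) ^ 2 - 2 / 3) := by
    have h1 : ∀ s ∈ S, frobSq ⁅Q, X s⁆ - 2 / 3
        = ∑ a, ∑ b, ‖coeffs U (X s) a b‖ ^ 2 * ((θ a + θ b) ^ 2 - 2 / 3) := by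
      intro s hs
      simp only [mul_sub, Finset.sum_sub_distrib, ← Finset.sum_mul, hone s hs, hlie, one_mul,
        mul_comm (‖coeffs U (X s) _ _‖ ^ 2) ((θ _ + θ _) ^ 2)]
    rw [Finset.sum_congr rfl h1, Finset.sum_comm]
    refine Finset.sum_congr rfl fun a _ => ?_
    rw [Finset.sum_comm]
    simp only [p, Finset.sum_mul]
  set g : Fin n → Fin n → ℝ := fun a b =>
    if a = b then 0 else 1 / 2 * max ((θ a + θ b) ^ 2 - 2 / 3) 0 with hg
  have hterm : ∀ a b, p a b * ((θ a + θ b) ^ 2 - 2 / 3) ≤ g a b := by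
    intro a b
    by_cases hab : a = b
    · simp only [hg, if_pos hab]; rw [hab, hpd]; simp
    · simp only [hg, if_neg hab]
      calc p a b * ((θ a + θ b) ^ 2 - 2 / 3) ≤ p a b * max ((θ a + θ b) ^ 2 - 2 / 3) 0 :=
            mul_le_mul_of_nonneg_left (le_max_left _ _) (hp0 a b)
        _ ≤ _ := mul_le_mul_of_nonneg_right (hp1 a b hab) (le_max_right _ _)
  have hgsum : ∑ a, ∑ b, g a b
      = 1 / 2 * ∑ a, ∑ b ∈ Finset.univ.erase a, max ((θ a + θ b) ^ 2 - 2 / 3) 0 := by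
    rw [Finset.mul_sum]
    refine Finset.sum_congr rfl fun a _ => ?_
    rw [← Finset.add_sum_erase _ _ (Finset.mem_univ a), Finset.mul_sum]
    simp only [hg, if_true, zero_add]
    exact Finset.sum_congr rfl fun b hb => if_neg (Finset.ne_of_mem_erase hb).symm
  have hrow : ∀ a ∈ Finset.univ, ∑ b, p a b * ((θ a + θ b) ^ 2 - 2 / 3) ≤ ∑ b, g a b :=
    fun a _ => Finset.sum_le_sum fun b _ => hterm a b
  have htot := Finset.sum_le_sum hrow
  rw [hsum]
  refine ⟨by linarith, fun hE => ?_⟩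
  have hθ := heq (by linarith)
  have hrow' := (Finset.sum_eq_sum_iff_of_le hrow).1 (by linarith)
  have hterm' : ∀ a b, p a b * ((θ a + θ b) ^ 2 - 2 / 3) = g a b := fun a b =>
    (Finset.sum_eq_sum_iff_of_le fun b _ => hterm a b).1 (hrow' a (Finset.mem_univ a)) b
      (Finset.mem_univ b)
  -- With `θ` in `{0, 1/2, -1/2}`, the number `(θ a + θ b) ^ 2` is `0`, `1 / 4` or `1`. Weight at a
  -- position where it is not `1` would make the estimate strict.
  have hsupp : ∀ s ∈ S, ∀ a b, coeffs U (X s) a b ≠ 0 → θ a ^ 2 = 1 / 4 ∧ θ b = θ a := by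
    intro s hs a b hne
    have hab : a ≠ b := by rintro rfl; exact hne (hdiag s hs a)
    have hppos : 0 < p a b := by
      refine lt_of_lt_of_le ?_ (Finset.single_le_sum
        (f := fun s => ‖coeffs U (X s) a b‖ ^ 2) (fun _ _ => sq_nonneg _) hs)
      have := norm_pos_iff.2 hne
      positivity
    have h1 := hterm' a b
    simp only [hg, if_neg hab] at h1
    by_contra hcon
    have h2 : (θ a + θ b) ^ 2 - 2 / 3 < 0 := by
      rcases hθ a with ha | ha | ha <;> rcases hθ b with hb | hb | hb <;> rw [ha, hb] at hcon ⊢ <;>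
        first | (norm_num; done) | exact absurd (by norm_num) hcon
    rw [max_eq_right h2.le] at h1
    nlinarith
  have hlie1 : ∀ s ∈ S, frobSq ⁅Q, X s⁆ = 1 := by
    intro s hs
    rw [hlie, ← hone s hs]
    refine Finset.sum_congr rfl fun a _ => Finset.sum_congr rfl fun b _ => ?_
    by_cases hne : coeffs U (X s) a b = 0
    · simp [hne]
    · obtain ⟨h1, h2⟩ := hsupp s hs a b hne
      rw [h2]; linear_combination 4 * ‖coeffs U (X s) a b‖ ^ 2 * h1
  refine ⟨?_, fun s hs => ⟨hlie1 s hs, ?_, ?_⟩⟩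
  -- Each member contributes `1 - 2 / 3 = 1 / 3` to a total of `2 / 3`.
  · rw [← hsum, Finset.sum_congr rfl fun s hs => by rw [hlie1 s hs], Finset.sum_const,
      nsmul_eq_mul] at hE
    have : (S.card : ℝ) = 2 := by linarith
    exact_mod_cast this
  · apply coeffs_injective hU'
    ext a b
    rw [coeffs_mul_right hQ hU hU' h, coeffs_mul_left hU hU' h, coeffs_smul, Matrix.smul_apply,
      smul_eq_mul]
    by_cases hne : coeffs U (X s) a b = 0
    · simp [hne]
    · obtain ⟨h1, h2⟩ := hsupp s hs a b hne
      have h1' : (θ a : ℂ) ^ 2 = 1 / 4 := by rw [← Complex.ofReal_pow, h1]; norm_num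
      rw [h2]; push_cast
      linear_combination coeffs U (X s) a b * h1' -
        θ a ^ 2 * coeffs U (X s) a b * Complex.I_sq
  · apply coeffs_injective hU'
    ext a b
    rw [coeffs_mul_left hU hU' h, coeffs_mul_left hU hU' h, coeffs_smul, Matrix.smul_apply,
      smul_eq_mul]
    by_cases hne : coeffs U (X s) a b = 0
    · simp [hne]
    · obtain ⟨h1, h2⟩ := hsupp s hs a b hne
      have h1' : (θ a : ℂ) ^ 2 = 1 / 4 := by rw [← Complex.ofReal_pow, h1]; norm_num
      push_cast
      linear_combination -coeffs U (X s) a b * h1' +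
        θ a ^ 2 * coeffs U (X s) a b * Complex.I_sq

end Key

/-! ### From row bounds to a bound on the quadratic form. -/

section Weights

/-- Bound `x r * x s` by the mean of the squares wherever `k r s` exceeds `c`, and drop the other
off-diagonal terms. The diagonal supplies `-c * x r ^ 2`, so everything is at most `∑ x r ^ 2 * (∑ h
r s - c)`, where `h` is the positive part of `k - c` off the diagonal. The hypothesis for `S = {s |
c < k r s}` makes each factor nonpositive. Equality in the mean inequality is what forces equal
weights. -/
lemma weighted_sum_le {ι : Type*} [DecidableEq ι] (I : Finset ι) {x : ι → ℝ} {k : ι → ι → ℝ}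
    {c : ℝ} (hx : ∀ r ∈ I, 0 < x r) (hsymm : ∀ r s, k r s = k s r) (hk : ∀ r, k r r = 0)
    (hS : ∀ r ∈ I, ∀ S ⊆ I.erase r, ∑ s ∈ S, (k r s - c) ≤ c) :
    ∑ r ∈ I, ∑ s ∈ I, x r * x s * k r s ≤ c * (∑ r ∈ I, x r) ^ 2 ∧
      (∑ r ∈ I, ∑ s ∈ I, x r * x s * k r s = c * (∑ r ∈ I, x r) ^ 2 → ∀ r ∈ I,
        ∑ s ∈ I.erase r, (k r s - c) = c ∧ ∀ s ∈ I, s ≠ r → c < k r s → x r = x s) := by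
  set h : ι → ι → ℝ := fun r s => if r = s then 0 else max (k r s - c) 0 with hh
  have hsymm' : ∀ r s, h r s = h s r := fun r s => by
    simp only [hh, hsymm r s, eq_comm (a := r)]
  have hterm : ∀ r ∈ I, ∀ s ∈ I, x r * x s * (k r s - c) ≤
      1 / 2 * (x r ^ 2 + x s ^ 2) * h r s - if r = s then c * x r ^ 2 else 0 := by
    intro r hr s hs
    by_cases hrs : r = s
    · subst hrs; simp only [hh, if_true, hk]; apply le_of_eq; ring
    · simp only [hh, if_neg hrs, sub_zero]
      calc x r * x s * (k r s - c) ≤ x r * x s * max (k r s - c) 0 :=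
            mul_le_mul_of_nonneg_left (le_max_left _ _) (mul_pos (hx r hr) (hx s hs)).le
        _ ≤ _ := mul_le_mul_of_nonneg_right (by nlinarith [sq_nonneg (x r - x s)])
            (le_max_right _ _)
  have hhsum : ∀ r ∈ I, ∑ s ∈ I, h r s = ∑ s ∈ I.erase r with c < k r s, (k r s - c) := by
    intro r hr
    rw [← Finset.add_sum_erase _ _ hr, Finset.sum_filter]
    simp only [hh, if_true, zero_add]
    refine Finset.sum_congr rfl fun s hs => ?_
    rw [if_neg (Finset.ne_of_mem_erase hs).symm]
    split_ifs with hc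
    · exact max_eq_left (by linarith)
    · exact max_eq_right (by linarith)
  have hhc : ∀ r ∈ I, ∑ s ∈ I, h r s ≤ c := fun r hr => by
    rw [hhsum r hr]; exact hS r hr _ (Finset.filter_subset _ _)
  have hL : ∑ r ∈ I, ∑ s ∈ I, x r * x s * (k r s - c)
      = ∑ r ∈ I, ∑ s ∈ I, x r * x s * k r s - c * (∑ r ∈ I, x r) ^ 2 := by
    rw [sq, Finset.sum_mul_sum]
    simp only [mul_sub, Finset.sum_sub_distrib, Finset.mul_sum]
    simp only [mul_comm c]
  have hR : ∑ r ∈ I, ∑ s ∈ I, (1 / 2 * (x r ^ 2 + x s ^ 2) * h r s -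
      if r = s then c * x r ^ 2 else 0) = ∑ r ∈ I, x r ^ 2 * (∑ s ∈ I, h r s - c) := by
    have h1 : ∑ r ∈ I, ∑ s ∈ I, x s ^ 2 * h r s = ∑ r ∈ I, ∑ s ∈ I, x r ^ 2 * h r s := by
      rw [Finset.sum_comm]; simp only [hsymm']
    have h2 : ∑ r ∈ I, ∑ s ∈ I, 1 / 2 * (x r ^ 2 + x s ^ 2) * h r s
        = ∑ r ∈ I, ∑ s ∈ I, x r ^ 2 * h r s := by
      have : ∀ r s, 1 / 2 * (x r ^ 2 + x s ^ 2) * h r s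
          = 1 / 2 * (x r ^ 2 * h r s) + 1 / 2 * (x s ^ 2 * h r s) := fun r s => by ring
      simp only [this, Finset.sum_add_distrib, ← Finset.mul_sum]
      rw [h1]; simp only [← Finset.mul_sum]; ring
    simp only [Finset.sum_sub_distrib, h2, mul_sub, Finset.mul_sum]
    congr 1
    exact Finset.sum_congr rfl fun r hr => by rw [Finset.sum_ite_eq, if_pos hr, mul_comm]
  have hrow : ∀ r ∈ I, ∑ s ∈ I, x r * x s * (k r s - c) ≤ ∑ s ∈ I,
      (1 / 2 * (x r ^ 2 + x s ^ 2) * h r s - if r = s then c * x r ^ 2 else 0) :=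
    fun r hr => Finset.sum_le_sum fun s hs => hterm r hr s hs
  have hle := Finset.sum_le_sum hrow
  have hneg : ∀ r ∈ I, x r ^ 2 * (∑ s ∈ I, h r s - c) ≤ 0 := fun r hr =>
    mul_nonpos_of_nonneg_of_nonpos (sq_nonneg _) (by linarith [hhc r hr])
  have hneg' := Finset.sum_nonpos hneg
  refine ⟨by linarith, fun hE r hr => ?_⟩
  have e1 := (Finset.sum_eq_zero_iff_of_nonpos hneg).1 (by linarith) r hr
  have e2 : ∑ s ∈ I, h r s = c := by
    have := (mul_eq_zero.1 e1).resolve_left (pow_pos (hx r hr) 2).ne'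
    linarith
  have e3 := (Finset.sum_eq_sum_iff_of_le hrow).1 (by linarith) r hr
  have e4 := (Finset.sum_eq_sum_iff_of_le fun s hs => hterm r hr s hs).1 e3
  have e5 : ∀ s ∈ I, s ≠ r → x r * x s * (k r s - c) =
      1 / 2 * (x r ^ 2 + x s ^ 2) * max (k r s - c) 0 := by
    intro s hs hsr
    have := e4 s hs
    simpa only [hh, if_neg hsr.symm, sub_zero] using this
  have e6 : ∀ s ∈ I, s ≠ r → c ≤ k r s := by
    intro s hs hsr
    by_contra! hlt
    have h1 := e5 s hs hsr
    rw [max_eq_right (by linarith), mul_zero] at h1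
    have := mul_pos (hx r hr) (hx s hs)
    nlinarith
  constructor
  · rw [← Finset.add_sum_erase _ _ hr] at e2
    simp only [hh, if_true, zero_add] at e2
    rw [← e2]
    refine Finset.sum_congr rfl fun s hs => ?_
    have hsr := Finset.ne_of_mem_erase hs
    rw [if_neg hsr.symm, max_eq_left]
    · rw [e2]
    · linarith [e6 s (Finset.mem_of_mem_erase hs) hsr]
  · intro s hs hsr hlt
    have h1 := e5 s hs hsr
    rw [max_eq_left (by linarith)] at h1
    have h2 : (k r s - c) * (x r - x s) ^ 2 = 0 := by linear_combination -2 * h1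
    have h3 := (mul_eq_zero.1 h2).resolve_left (by linarith)
    have := pow_eq_zero_iff two_ne_zero |>.1 h3
    linarith

end Weights

/-! ### Orthogonal mixing of a tuple. -/

section Rotation
variable {n N : ℕ}

/-- The Frobenius inner product of real matrices. -/
noncomputable def frobInner (X Y : Matrix (Fin n) (Fin n) ℝ) : ℝ := ∑ i, ∑ j, X i j * Y i j

lemma frobInner_eq_trace (X Y : Matrix (Fin n) (Fin n) ℝ) :
    frobInner X Y = Matrix.trace (X * Yᵀ) := by
  simp [frobInner, Matrix.trace, Matrix.mul_apply]

lemma frobInner_self (X : Matrix (Fin n) (Fin n) ℝ) : frobInner X X = frobSq X := by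
  simp [frobInner, frobSq, sq]

lemma frobInner_smul_smul (a b : ℝ) (X Y : Matrix (Fin n) (Fin n) ℝ) :
    frobInner (a • X) (b • Y) = a * b * frobInner X Y := by
  simp [frobInner_eq_trace]; ring

lemma frobInner_sum_sum (a b : Fin N → ℝ) (A : Fin N → Matrix (Fin n) (Fin n) ℝ) :
    frobInner (∑ j, a j • A j) (∑ k, b k • A k)
      = ∑ j, a j * ∑ k, frobInner (A j) (A k) * b k := by
  rw [frobInner_eq_trace, Matrix.transpose_sum, Finset.sum_mul_sum]
  simp only [frobInner_eq_trace, Matrix.trace_sum, Matrix.transpose_smul, Matrix.smul_mul,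
    Matrix.mul_smul, Matrix.trace_smul, smul_eq_mul,
    Finset.mul_sum]
  exact Finset.sum_congr rfl fun j _ => Finset.sum_congr rfl fun k _ => by ring

/-- The combinations of the matrices `A j` with coefficients the columns of `R`. -/
noncomputable def rotate (R : Matrix (Fin N) (Fin N) ℝ) (A : Fin N → Matrix (Fin n) (Fin n) ℝ) :
    Fin N → Matrix (Fin n) (Fin n) ℝ :=
  fun k => ∑ j, R j k • A j

lemma sum_frobSq_rotate {R : Matrix (Fin N) (Fin N) ℝ} (hR : R * Rᵀ = 1)
    (A : Fin N → Matrix (Fin n) (Fin n) ℝ) :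
    ∑ k, frobSq (rotate R A k) = ∑ k, frobSq (A k) := by
  have h : ∀ v : Fin N → ℝ, ∑ k, (∑ j, R j k * v j) ^ 2 = ∑ j, v j ^ 2 := by
    intro v
    have h1 : (Rᵀ *ᵥ v) ⬝ᵥ (Rᵀ *ᵥ v) = v ⬝ᵥ v := by
      rw [Matrix.dotProduct_mulVec, Matrix.vecMul_transpose, Matrix.mulVec_mulVec, hR,
        Matrix.one_mulVec]
    simpa [dotProduct, Matrix.mulVec, sq] using h1
  have e : ∀ A : Fin N → Matrix (Fin n) (Fin n) ℝ,
      ∑ k, frobSq (A k) = ∑ i, ∑ j, ∑ k, A k i j ^ 2 := by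
    intro A
    simp only [frobSq, Real.norm_eq_abs, sq_abs]
    rw [Finset.sum_comm]
    exact Finset.sum_congr rfl fun i _ => Finset.sum_comm
  rw [e, e]
  refine Finset.sum_congr rfl fun i _ => Finset.sum_congr rfl fun j _ => ?_
  rw [← h fun k => A k i j]
  simp [rotate, Matrix.sum_apply]

lemma lie_sum_smul (c : Fin N → ℝ) (A : Fin N → Matrix (Fin n) (Fin n) ℝ)
    (X : Matrix (Fin n) (Fin n) ℝ) : ⁅X, ∑ j, c j • A j⁆ = ∑ j, c j • ⁅X, A j⁆ := by
  simp [Ring.lie_def, Finset.mul_sum, Finset.sum_mul, smul_sub]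

lemma frobSq_lie_comm (X Y : Matrix (Fin n) (Fin n) ℝ) : frobSq ⁅X, Y⁆ = frobSq ⁅Y, X⁆ := by
  rw [← frobSq_neg]; congr 1; simp [Ring.lie_def]

lemma sum_frobSq_lie_rotate {R : Matrix (Fin N) (Fin N) ℝ} (hR : R * Rᵀ = 1)
    (A : Fin N → Matrix (Fin n) (Fin n) ℝ) :
    ∑ k, ∑ l, frobSq ⁅rotate R A k, rotate R A l⁆ = ∑ k, ∑ l, frobSq ⁅A k, A l⁆ := by
  have h : ∀ X : Matrix (Fin n) (Fin n) ℝ, ∑ l, frobSq ⁅X, rotate R A l⁆ = ∑ l, frobSq ⁅X, A l⁆ := by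
    intro X
    simp only [rotate, lie_sum_smul]
    exact sum_frobSq_rotate hR fun j => ⁅X, A j⁆
  simp only [h]
  rw [Finset.sum_comm]
  simp only [frobSq_lie_comm (rotate R A _), h]

/-- The columns of `R` are orthonormal eigenvectors of the Gram matrix of the tuple. -/
lemma exists_rotate_orthogonal (A : Fin N → Matrix (Fin n) (Fin n) ℝ) :
    ∃ R : Matrix (Fin N) (Fin N) ℝ, R * Rᵀ = 1 ∧ Rᵀ * R = 1 ∧
      ∀ k l, k ≠ l → frobInner (rotate R A k) (rotate R A l) = 0 := by
  have hG : (Matrix.of fun j k => frobInner (A j) (A k)).IsHermitian := by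
    ext j k
    simp [frobInner, mul_comm]
  have hU := hG.eigenvectorUnitary.2
  have hU' := Matrix.mem_unitaryGroup_iff'.1 hU
  refine ⟨hG.eigenvectorUnitary, Matrix.mem_unitaryGroup_iff.1 hU, hU', ?_⟩
  intro k l hkl
  rw [rotate, rotate, frobInner_sum_sum]
  have h1 := hG.mulVec_eigenvectorBasis l
  have h2 : ∀ j, ∑ i, frobInner (A j) (A i) * (hG.eigenvectorUnitary : Matrix _ _ ℝ) i l
      = hG.eigenvalues l * (hG.eigenvectorUnitary : Matrix _ _ ℝ) j l := by
    intro j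
    have := congrFun h1 j
    simpa [Matrix.mulVec, dotProduct, Matrix.IsHermitian.eigenvectorUnitary_apply] using this
  have h3 := congrFun (congrFun hU' k) l
  rw [Matrix.mul_apply, Matrix.one_apply_ne hkl] at h3
  simp only [Matrix.star_apply, star_trivial] at h3
  simp only [h2]
  calc _ = hG.eigenvalues l * ∑ j, (hG.eigenvectorUnitary : Matrix (Fin N) (Fin N) ℝ) j k *
        (hG.eigenvectorUnitary : Matrix (Fin N) (Fin N) ℝ) j l := by
        rw [Finset.mul_sum]; exact Finset.sum_congr rfl fun j _ => by ring
    _ = 0 := by rw [h3, mul_zero]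

end Rotation

/-! ### The inequality for real skew-symmetric tuples of any size. -/

section Real
variable {n N : ℕ}

/-- Three unit skew-symmetric matrices satisfying the relations of (half) the quaternion units. -/
structure IsQuaternionic (Q : Fin 3 → Matrix (Fin n) (Fin n) ℝ) : Prop where
  skew : ∀ a, (Q a)ᵀ = -Q a
  norm : ∀ a, frobSq (Q a) = 1
  mul_mul_self : ∀ a b, a ≠ b → Q a * Q b * Q a = (1 / 4 : ℝ) • Q b
  sq_mul : ∀ a b, a ≠ b → Q a * (Q a * Q b) = (-1 / 4 : ℝ) • Q b

lemma rotate_transpose {A : Fin N → Matrix (Fin n) (Fin n) ℝ} (hA : ∀ j, (A j)ᵀ = -A j)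
    (R : Matrix (Fin N) (Fin N) ℝ) (k : Fin N) : (rotate R A k)ᵀ = -rotate R A k := by
  simp [rotate, Matrix.transpose_sum, hA]

lemma lie_smul_smul (a b : ℝ) (X Y : Matrix (Fin n) (Fin n) ℝ) :
    ⁅a • X, b • Y⁆ = (a * b) • ⁅X, Y⁆ := by
  simp [Ring.lie_def, smul_sub, smul_smul, mul_comm]

/-- A combination of the `A j` whose coefficients are orthogonal to the columns of `R` where
`rotate R A` does not vanish is zero. -/
lemma sum_smul_eq_zero {R : Matrix (Fin N) (Fin N) ℝ} (hR : R * Rᵀ = 1)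
    (A : Fin N → Matrix (Fin n) (Fin n) ℝ) (u : Fin N → ℝ)
    (hu : ∀ k, rotate R A k ≠ 0 → ∑ j, R j k * u j = 0) : ∑ j, u j • A j = 0 := by
  have h : ∑ k, (∑ j, R j k * u j) • rotate R A k = ∑ j, u j • A j := by
    have h1 : ∀ i, ∑ k, (∑ j, R j k * u j) * R i k = u i := by
      intro i
      have : R *ᵥ (Rᵀ *ᵥ u) = u := by rw [Matrix.mulVec_mulVec, hR, Matrix.one_mulVec]
      have := congrFun this i
      simp only [Matrix.mulVec, dotProduct, Matrix.transpose_apply] at this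
      rw [← this]
      exact Finset.sum_congr rfl fun k _ => mul_comm _ _
    simp only [rotate, Finset.smul_sum, smul_smul]
    rw [Finset.sum_comm]
    refine Finset.sum_congr rfl fun i _ => ?_
    rw [← Finset.sum_smul, h1]
  rw [← h]
  refine Finset.sum_eq_zero fun k _ => ?_
  by_cases hk : rotate R A k = 0
  · rw [hk, smul_zero]
  · rw [hu k hk, zero_smul]

/-- The inequality for real skew-symmetric matrices of any size, with the structure of the
equality case. -/
lemma sum_frobSq_lie_le {A : Fin N → Matrix (Fin n) (Fin n) ℝ} (hA : ∀ j, (A j)ᵀ = -A j) :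
    ∑ j, ∑ k, frobSq ⁅A j, A k⁆ ≤ 2 / 3 * (∑ j, frobSq (A j)) ^ 2 ∧
      (∑ j, ∑ k, frobSq ⁅A j, A k⁆ = 2 / 3 * (∑ j, frobSq (A j)) ^ 2 → (∀ j, A j = 0) ∨
        ∃ (w : Fin 3 → Fin N → ℝ) (x : ℝ) (Q : Fin 3 → Matrix (Fin n) (Fin n) ℝ),
          (∀ a b, ∑ i, w a i * w b i = if a = b then 1 else 0) ∧ 0 < x ∧ IsQuaternionic Q ∧
          (∀ a, ∑ j, w a j • A j = x • Q a) ∧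
          ∀ u : Fin N → ℝ, (∀ a, ∑ j, w a j * u j = 0) → ∑ j, u j • A j = 0) := by
  obtain ⟨R, hR, hR', horth⟩ := exists_rotate_orthogonal A
  set A' := rotate R A with hA'
  have hskew : ∀ k, (A' k)ᵀ = -A' k := rotate_transpose hA R
  set x : Fin N → ℝ := fun k => frobSq (A' k) with hx
  set I := Finset.univ.filter fun k => 0 < x k with hI
  have hmemI : ∀ k, k ∈ I ↔ 0 < x k := fun k => by simp [hI]
  have hzero : ∀ k, k ∉ I → A' k = 0 := by
    intro k hk
    rw [hmemI, not_lt] at hk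
    exact frobSq_eq_zero (le_antisymm hk (frobSq_nonneg _))
  set Q : Fin N → Matrix (Fin n) (Fin n) ℝ := fun k => (Real.sqrt (x k))⁻¹ • A' k with hQ
  have hQskew : ∀ k, (Q k)ᵀ = -Q k := fun k => by
    simp [hQ, hskew]
  have hsqrt : ∀ k ∈ I, 0 < Real.sqrt (x k) := fun k hk => Real.sqrt_pos.2 ((hmemI k).1 hk)
  have hAQ : ∀ k ∈ I, A' k = Real.sqrt (x k) • Q k := fun k hk => by
    rw [hQ]; simp only [smul_smul]; rw [mul_inv_cancel₀ (hsqrt k hk).ne', one_smul]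
  have hQ1 : ∀ k ∈ I, frobSq (Q k) = 1 := fun k hk => by
    have h0 := (hmemI k).1 hk
    rw [hQ, frobSq_smul, inv_pow, Real.sq_sqrt h0.le]
    exact inv_mul_cancel₀ h0.ne'
  have hQorth : ∀ k ∈ I, ∀ l ∈ I, ∑ i, ∑ j, Q k i j * Q l i j = if k = l then 1 else 0 := by
    intro k hk l hl
    change frobInner (Q k) (Q l) = _
    split_ifs with hkl
    · subst hkl; rw [frobInner_self, hQ1 k hk]
    · rw [hQ, frobInner_smul_smul, horth k l hkl, mul_zero]
  set κ : Fin N → Fin N → ℝ := fun k l => frobSq ⁅Q k, Q l⁆ with hκ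
  have hkey : ∀ r ∈ I, ∀ S ⊆ I.erase r, _ := fun r hr S hS =>
    sum_frobSq_lie_sub_le (hQskew r) (hQ1 r hr) S (fun s _ => hQskew s)
      (fun s hs t ht => hQorth s (Finset.mem_of_mem_erase (hS hs)) t
        (Finset.mem_of_mem_erase (hS ht)))
  obtain ⟨hle, heq⟩ := weighted_sum_le I (x := x) (k := κ) (c := 2 / 3)
    (fun r hr => (hmemI r).1 hr) (fun r s => frobSq_lie_comm _ _)
    (fun r => by simp [hκ, Ring.lie_def]) (fun r hr S hS => (hkey r hr S hS).1)
  have hF : ∑ j, ∑ k, frobSq ⁅A j, A k⁆ = ∑ r ∈ I, ∑ s ∈ I, x r * x s * κ r s := by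
    rw [← sum_frobSq_lie_rotate hR, ← hA']
    have h1 : ∀ r, ∑ s, frobSq ⁅A' r, A' s⁆ = ∑ s ∈ I, frobSq ⁅A' r, A' s⁆ := by
      intro r
      symm
      refine Finset.sum_subset (Finset.subset_univ _) fun s _ hs => ?_
      rw [hzero s hs]; simp [Ring.lie_def]
    simp only [h1]
    symm
    have h2 : ∑ r ∈ I, ∑ s ∈ I, frobSq ⁅A' r, A' s⁆ = ∑ r, ∑ s ∈ I, frobSq ⁅A' r, A' s⁆ := by
      refine Finset.sum_subset (Finset.subset_univ _) fun r _ hr => ?_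
      rw [hzero r hr]; simp [Ring.lie_def]
    rw [← h2]
    refine Finset.sum_congr rfl fun r hr => Finset.sum_congr rfl fun s hs => ?_
    rw [hAQ r hr, hAQ s hs, lie_smul_smul, frobSq_smul, mul_pow,
      Real.sq_sqrt ((hmemI r).1 hr).le, Real.sq_sqrt ((hmemI s).1 hs).le]
  have hX : ∑ j, frobSq (A j) = ∑ r ∈ I, x r := by
    rw [← sum_frobSq_rotate hR, ← hA']
    symm
    refine Finset.sum_subset (Finset.subset_univ _) fun r _ hr => ?_
    simp [hx, hzero r hr]
  rw [hF, hX]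
  refine ⟨hle, fun hE => ?_⟩
  rcases I.eq_empty_or_nonempty with hIe | ⟨r, hr⟩
  · left
    intro j
    have := sum_smul_eq_zero hR A (Pi.single j 1) fun k hk =>
      absurd (hzero k (by rw [hIe]; simp)) hk
    simpa [Pi.single_apply, ite_smul] using this
  right
  -- Equality holds in the key estimate for each `r ∈ I` against all the others, so `I.erase r` has
  -- two elements and `I` has three.
  have hEr := fun r hr => (hkey r hr _ subset_rfl).2 (heq hE r hr).1
  have hcard : Fintype.card (Fin 3) = Fintype.card I := by
    rw [Fintype.card_coe, ← Finset.card_erase_add_one hr, (hEr r hr).1, Fintype.card_fin]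
  obtain ⟨e⟩ : Nonempty (Fin 3 ≃ I) := Fintype.card_eq.1 hcard
  have hne : ∀ a b, a ≠ b → (e b : Fin N) ∈ I.erase (e a) := fun a b hab =>
    Finset.mem_erase.2 ⟨fun h => hab (e.injective (Subtype.ext h)).symm, (e b).2⟩
  have hxe : ∀ a, x (e a) = x r := by
    intro a
    by_cases har : (e a : Fin N) = r
    · rw [har]
    -- The weights agree because the squared commutator norm is `1`, above the threshold `2 / 3`.
    · refine ((heq hE r hr).2 (e a) (e a).2 har ?_).symm
      simp only [hκ]
      rw [((hEr r hr).2 (e a) (Finset.mem_erase.2 ⟨har, (e a).2⟩)).1]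
      norm_num
  refine ⟨fun a j => R j (e a), Real.sqrt (x r), fun a => Q (e a), ?_, hsqrt r hr,
    ⟨fun a => hQskew _, fun a => hQ1 _ (e a).2,
      fun a b hab => ((hEr _ (e a).2).2 _ (hne a b hab)).2.1,
      fun a b hab => ((hEr _ (e a).2).2 _ (hne a b hab)).2.2⟩, ?_, ?_⟩
  · intro a b
    have h1 := congrFun (congrFun hR' (e a)) (e b)
    rw [Matrix.mul_apply, Matrix.one_apply] at h1
    simp only [Matrix.transpose_apply] at h1
    rw [h1]
    simp only [← Subtype.ext_iff, e.injective.eq_iff]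
  · intro a
    rw [← hxe a]
    exact hAQ _ (e a).2
  · intro u hu
    refine sum_smul_eq_zero hR A u fun k hk => ?_
    have hkI : k ∈ I := by
      by_contra hcon
      exact hk (hzero k hcon)
    have := hu (e.symm ⟨k, hkI⟩)
    simpa using this

end Real

/-! ### Block matrices and completion to an orthogonal basis. -/

section NormalForm
variable {k d : ℕ}

/-- The block matrix `diag(X, 0)`. -/
noncomputable def padZero (d : ℕ) (X : Matrix (Fin k) (Fin k) ℝ) :
    Matrix (Fin (k + d)) (Fin (k + d)) ℝ :=
  (Matrix.fromBlocks X 0 0 0).submatrix finSumFinEquiv.symm finSumFinEquiv.symm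

@[simp] lemma padZero_castAdd_castAdd (X : Matrix (Fin k) (Fin k) ℝ) (a b : Fin k) :
    padZero d X (Fin.castAdd d a) (Fin.castAdd d b) = X a b := by simp [padZero]

@[simp] lemma padZero_natAdd_left (X : Matrix (Fin k) (Fin k) ℝ) (i : Fin d) (j : Fin (k + d)) :
    padZero d X (Fin.natAdd k i) j = 0 := by
  refine Fin.addCases (fun b => ?_) (fun b => ?_) j <;>
    simp [padZero, -Fin.natAdd_eq_addNat]

@[simp] lemma padZero_natAdd_right (X : Matrix (Fin k) (Fin k) ℝ) (i : Fin (k + d)) (j : Fin d) :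
    padZero d X i (Fin.natAdd k j) = 0 := by
  refine Fin.addCases (fun b => ?_) (fun b => ?_) i <;>
    simp [padZero, -Fin.natAdd_eq_addNat]

lemma padZero_smul (c : ℝ) (X : Matrix (Fin k) (Fin k) ℝ) :
    padZero d (c • X) = c • padZero d X := by
  ext i j
  refine Fin.addCases (fun a => ?_) (fun a => ?_) i <;>
  refine Fin.addCases (fun b => ?_) (fun b => ?_) j <;> simp [-Fin.natAdd_eq_addNat]

lemma lie_padZero (X Y : Matrix (Fin k) (Fin k) ℝ) :
    ⁅padZero d X, padZero d Y⁆ = padZero d ⁅X, Y⁆ := by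
  ext i j
  refine Fin.addCases (fun a => ?_) (fun a => ?_) i <;>
  refine Fin.addCases (fun b => ?_) (fun b => ?_) j <;>
    simp [Ring.lie_def, Matrix.mul_apply, Fin.sum_univ_add, -Fin.natAdd_eq_addNat]

lemma frobSq_padZero (X : Matrix (Fin k) (Fin k) ℝ) : frobSq (padZero d X) = frobSq X := by
  simp [frobSq, Fin.sum_univ_add, -Fin.natAdd_eq_addNat]

lemma transpose_mul_mul_eq_padZero {P Q : Matrix (Fin (k + d)) (Fin (k + d)) ℝ}
    (hP : Pᵀ * P = 1) (X : Matrix (Fin k) (Fin k) ℝ)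
    (h1 : ∀ b, Q *ᵥ P.col (Fin.castAdd d b) = ∑ a, X a b • P.col (Fin.castAdd d a))
    (h2 : ∀ j, Q *ᵥ P.col (Fin.natAdd k j) = 0) : Pᵀ * Q * P = padZero d X := by
  have hQP : Q * P = P * padZero d X := by
    ext i j
    refine Fin.addCases (fun b => ?_) (fun b => ?_) j
    · have := congrFun (h1 b) i
      simp only [Matrix.mulVec, dotProduct, Matrix.col_apply, Finset.sum_apply, Pi.smul_apply,
        smul_eq_mul] at this
      simp [Matrix.mul_apply, this, Fin.sum_univ_add, mul_comm, -Fin.natAdd_eq_addNat]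
    · have := congrFun (h2 b) i
      simp only [Matrix.mulVec, dotProduct, Matrix.col_apply] at this
      simp [Matrix.mul_apply, this, -Fin.natAdd_eq_addNat]
  rw [Matrix.mul_assoc, hQP, ← Matrix.mul_assoc, hP, Matrix.one_mul]

/-- Orthonormal vectors are the first columns of an orthogonal matrix. -/
lemma exists_orthogonal_col_eq (w : Fin k → Fin (k + d) → ℝ)
    (hw : ∀ a b, w a ⬝ᵥ w b = if a = b then 1 else 0) :
    ∃ R : Matrix (Fin (k + d)) (Fin (k + d)) ℝ, R * Rᵀ = 1 ∧ Rᵀ * R = 1 ∧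
      ∀ a, R.col (Fin.castAdd d a) = w a := by
  -- The zeros are filler: only the restriction to the first `k` indices has to be orthonormal.
  let v : Fin (k + d) → EuclideanSpace ℝ (Fin (k + d)) :=
    Fin.append (fun a => WithLp.toLp 2 (w a)) 0
  let s : Set (Fin (k + d)) := Set.range (Fin.castAdd d)
  have hv : Orthonormal ℝ (s.domRestrict v) := by
    rw [orthonormal_iff_ite]
    rintro ⟨_, a, rfl⟩ ⟨_, b, rfl⟩
    have h : inner ℝ (v (Fin.castAdd d a)) (v (Fin.castAdd d b)) = w b ⬝ᵥ w a := by
      simp only [v, Fin.append_left]; rfl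
    refine (h.trans (hw b a)).trans ?_
    by_cases hab : b = a
    · subst hab; simp
    · rw [if_neg hab, if_neg]
      exact fun he => hab (Fin.castAdd_injective k d (Subtype.ext_iff.1 he)).symm
  obtain ⟨b, hb⟩ := hv.exists_orthonormalBasis_extension_of_card_eq (by simp)
  have hR : (Matrix.of fun i j => b j i)ᵀ * (Matrix.of fun i j => b j i) = 1 := by
    ext i j
    have := orthonormal_iff_ite.1 b.orthonormal j i
    rw [Matrix.mul_apply, Matrix.one_apply]
    refine Eq.trans rfl (this.trans ?_)
    simp only [eq_comm]
  refine ⟨Matrix.of fun i j => b j i, mul_eq_one_comm.1 hR, hR, fun a => ?_⟩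
  ext i
  simp [hb _ ⟨a, rfl⟩, v, Matrix.col_apply]

end NormalForm

/-! ### Normal form of a quaternionic triple. -/

section Quaternionic
variable {n : ℕ}

/-- Real versions of the three model matrices of size four. -/
def model₄ : Fin 3 → Matrix (Fin 4) (Fin 4) ℝ :=
  ![!![0, 1, 0, 0; -1, 0, 0, 0; 0, 0, 0, 1; 0, 0, -1, 0],
    !![0, 0, 1, 0; 0, 0, 0, -1; -1, 0, 0, 0; 0, 1, 0, 0],
    !![0, 0, 0, 1; 0, 0, 1, 0; 0, -1, 0, 0; -1, 0, 0, 0]]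

namespace IsQuaternionic
variable {Q : Fin 3 → Matrix (Fin n) (Fin n) ℝ}

lemma mul_mul_eq_neg (hQ : IsQuaternionic Q) {a b : Fin 3} (hab : a ≠ b) :
    Q b * (Q a * Q a) = (-1 / 4 : ℝ) • Q b := by
  have h := congrArg Matrix.transpose (hQ.sq_mul a b hab)
  simp only [Matrix.transpose_mul, Matrix.transpose_smul, hQ.skew, Matrix.neg_mul, Matrix.mul_neg,
    neg_neg, smul_neg] at h
  rw [neg_inj] at h
  rw [← h, Matrix.mul_assoc]

/-- Evaluate `Q a ^ 2 * Q b ^ 2` from either end. The common square gives all three matrices the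
same kernel. -/
lemma sq_eq_sq (hQ : IsQuaternionic Q) (a b : Fin 3) : Q a * Q a = Q b * Q b := by
  by_cases hab : a = b
  · rw [hab]
  have h1 : Q a * Q a * (Q b * Q b) = (-1 / 4 : ℝ) • (Q b * Q b) := by
    rw [← Matrix.mul_assoc, Matrix.mul_assoc (Q a), hQ.sq_mul a b hab, Matrix.smul_mul]
  have h2 : Q a * Q a * (Q b * Q b) = (-1 / 4 : ℝ) • (Q a * Q a) := by
    rw [Matrix.mul_assoc, hQ.mul_mul_eq_neg (Ne.symm hab), Matrix.mul_smul]
  rw [h1] at h2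
  exact (smul_right_injective _ (by norm_num : (-1 / 4 : ℝ) ≠ 0) h2).symm

/-- Compute `Q a * Q a * Q b * Q a` in two ways, starting from `Q a * Q a * Q b` or from `Q a * Q b
* Q a`. -/
lemma anticomm (hQ : IsQuaternionic Q) {a b : Fin 3} (hab : a ≠ b) :
    Q b * Q a = -(Q a * Q b) := by
  have h : (-1 / 4 : ℝ) • (Q b * Q a) = (1 / 4 : ℝ) • (Q a * Q b) := by
    rw [← Matrix.smul_mul, ← hQ.sq_mul a b hab, ← Matrix.mul_smul, ← hQ.mul_mul_self a b hab]
    simp only [Matrix.mul_assoc]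
  have h2 := congrArg (fun M => (-4 : ℝ) • M) h
  simp only [smul_smul] at h2
  norm_num at h2
  exact h2

lemma mul_sq (hQ : IsQuaternionic Q) (a b : Fin 3) :
    Q a * (Q a * Q b) = (-1 / 4 : ℝ) • Q b := by
  by_cases hab : a = b
  · subst hab
    obtain ⟨c, hc⟩ : ∃ c, c ≠ a := exists_ne a
    rw [← Matrix.mul_assoc, hQ.sq_eq_sq a c, Matrix.mul_assoc, hQ.sq_mul c a hc]
  · exact hQ.sq_mul a b hab

end IsQuaternionic

lemma mulVec_dotProduct_of_skew {M : Matrix (Fin n) (Fin n) ℝ} (hM : Mᵀ = -M)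
    (x y : Fin n → ℝ) : (M *ᵥ x) ⬝ᵥ y = -(x ⬝ᵥ (M *ᵥ y)) := by
  rw [dotProduct_comm, Matrix.dotProduct_mulVec, ← Matrix.mulVec_transpose, hM,
    Matrix.neg_mulVec, neg_dotProduct, dotProduct_comm]

/-- The normal form of a quaternionic triple, up to the sign of its last member. -/
lemma IsQuaternionic.exists_normalForm {d : ℕ} {Q : Fin 3 → Matrix (Fin (4 + d)) (Fin (4 + d)) ℝ}
    (hQ : IsQuaternionic Q) :
    ∃ (P : Matrix (Fin (4 + d)) (Fin (4 + d)) ℝ) (ε : Fin 3 → ℝ), P * Pᵀ = 1 ∧ Pᵀ * P = 1 ∧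
      (∀ a, ε a ^ 2 = 1) ∧
      ∀ a, Pᵀ * (ε a • Q a) * P = (1 / 2 : ℝ) • padZero d (model₄ a) := by
  set f : Fin 3 → (Fin (4 + d) → ℝ) → (Fin (4 + d) → ℝ) := fun a x => Q a *ᵥ x with hf
  have fdot : ∀ a x y, f a x ⬝ᵥ y = -(x ⬝ᵥ f a y) := fun a x y =>
    mulVec_dotProduct_of_skew (hQ.skew a) x y
  have fself : ∀ a x, x ⬝ᵥ f a x = 0 := by
    intro a x
    have := fdot a x x
    rw [dotProduct_comm] at this
    linarith
  have fanti : ∀ a b, a ≠ b → ∀ x, f b (f a x) = -f a (f b x) := by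
    intro a b hab x
    simp only [hf, Matrix.mulVec_mulVec, hQ.anticomm hab, Matrix.neg_mulVec]
  have fsmul : ∀ a (c : ℝ) x, f a (c • x) = c • f a x := fun a c x => Matrix.mulVec_smul _ _ _
  have fcube : ∀ a b x, f a (f a (f b x)) = (-1 / 4 : ℝ) • f b x := by
    intro a b x
    simp only [hf, Matrix.mulVec_mulVec, hQ.mul_sq, Matrix.smul_mulVec]
  -- a unit vector in the common range
  obtain ⟨v, hv1, hv⟩ : ∃ v, v ⬝ᵥ v = 1 ∧ ∀ a, f a (f a v) = (-1 / 4 : ℝ) • v := by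
    have hne : Q 0 ≠ 0 := by
      intro h
      have := hQ.norm 0
      rw [h, frobSq_zero] at this
      norm_num at this
    obtain ⟨z, hz⟩ : ∃ z, f 0 z ≠ 0 := by
      by_contra! hcon
      refine hne (Matrix.ext_of_mulVec_single fun i => ?_)
      rw [Matrix.zero_mulVec]
      exact hcon (Pi.single i 1)
    have hpos : 0 < f 0 z ⬝ᵥ f 0 z := by
      refine lt_of_le_of_ne ?_ ?_
      · simp only [dotProduct]; exact Finset.sum_nonneg fun _ _ => mul_self_nonneg _
      · exact fun h => hz (dotProduct_self_eq_zero.1 h.symm)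
    refine ⟨(Real.sqrt (f 0 z ⬝ᵥ f 0 z))⁻¹ • f 0 z, ?_, fun a => ?_⟩
    · rw [smul_dotProduct, dotProduct_smul, smul_smul, smul_eq_mul, ← sq, inv_pow,
        Real.sq_sqrt hpos.le, inv_mul_cancel₀ hpos.ne']
    · rw [fsmul, fsmul, fcube, smul_comm]
  have h00 := hv 0
  have h11 := hv 1
  have h10 : f 1 (f 0 v) = -f 0 (f 1 v) := fanti 0 1 (by decide) v
  have h001 : f 0 (f 0 (f 1 v)) = (-1 / 4 : ℝ) • f 1 v := fcube 0 1 v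
  have hunit : ∀ a, f a v ⬝ᵥ f a v = 1 / 4 := by
    intro a
    rw [fdot, hv, dotProduct_smul, hv1]; norm_num
  have horth : ∀ a b, a ≠ b → f a v ⬝ᵥ f b v = 0 := by
    intro a b hab
    have e1 := fdot a v (f b v)
    have e2 := fdot b v (f a v)
    rw [fanti a b hab, dotProduct_neg, neg_neg, dotProduct_comm] at e2
    linarith
  have h01 : f 0 v ⬝ᵥ f 1 v = 0 := horth 0 1 (by decide)
  -- The analogue of the quaternion basis `1, i, j, k`. Each `Q a` halves lengths here, hence the
  -- factors `2` and `4`; the signs are those that match `model₄`.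
  let e : Fin 4 → Fin (4 + d) → ℝ :=
    ![v, (-2 : ℝ) • f 0 v, (-2 : ℝ) • f 1 v, (4 : ℝ) • f 0 (f 1 v)]
  have e0 : e 0 = v := rfl
  have e1 : e 1 = (-2 : ℝ) • f 0 v := rfl
  have e2 : e 2 = (-2 : ℝ) • f 1 v := rfl
  have e3 : e 3 = (4 : ℝ) • f 0 (f 1 v) := rfl
  have A00 : f 0 (e 0) = (-1 / 2 : ℝ) • e 1 := by rw [e0, e1]; module
  have A01 : f 0 (e 1) = (1 / 2 : ℝ) • e 0 := by rw [e0, e1, fsmul, h00]; module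
  have A02 : f 0 (e 2) = (-1 / 2 : ℝ) • e 3 := by rw [e2, e3, fsmul]; module
  have A03 : f 0 (e 3) = (1 / 2 : ℝ) • e 2 := by rw [e2, e3, fsmul, h001]; module
  have A10 : f 1 (e 0) = (-1 / 2 : ℝ) • e 2 := by rw [e0, e2]; module
  have A11 : f 1 (e 1) = (1 / 2 : ℝ) • e 3 := by rw [e1, e3, fsmul, h10]; module
  have A12 : f 1 (e 2) = (1 / 2 : ℝ) • e 0 := by rw [e0, e2, fsmul, h11]; module
  have A13 : f 1 (e 3) = (-1 / 2 : ℝ) • e 1 := by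
    rw [e1, e3, fsmul, fanti 0 1 (by decide), h11, fsmul]; module
  have hv01 : v ⬝ᵥ f 0 (f 1 v) = 0 := by
    have := fdot 0 v (f 1 v); linarith
  have h0_01 : f 0 v ⬝ᵥ f 0 (f 1 v) = 0 := by
    rw [fdot, h001, dotProduct_smul, fself]; simp
  have h01_01 : f 0 (f 1 v) ⬝ᵥ f 0 (f 1 v) = 1 / 16 := by
    rw [fdot, h001, dotProduct_smul, hunit]; norm_num
  have he : ∀ a b, e a ⬝ᵥ e b = if a = b then 1 else 0 := by
    have hlt : ∀ a b, a < b → e a ⬝ᵥ e b = 0 := by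
      intro a b hab
      fin_cases a <;> fin_cases b <;> simp [e, fself, h01, hv01, h0_01] at hab ⊢
    intro a b
    rcases lt_trichotomy a b with h | h | h
    · rw [hlt a b h, if_neg h.ne]
    · subst h
      rw [if_pos rfl]
      fin_cases a <;> simp [e, hv1, hunit, h01_01] <;> norm_num
    · rw [dotProduct_comm, hlt b a h, if_neg h.ne']
  obtain ⟨P, hP, hP', hPe⟩ := exists_orthogonal_col_eq e he
  -- the remaining columns are in the common kernel
  have hker0 : ∀ j, f 0 (P.col (Fin.natAdd 4 j)) = 0 := by
    -- The four vectors `e a` already use up the whole squared norm `1` of `Q 0`, `1 / 4` each, so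
    -- `Q 0` kills the other columns.
    have htot : ∑ j, f 0 (P.col j) ⬝ᵥ f 0 (P.col j) = 1 := by
      rw [← hQ.norm 0, ← frobSq_unitary_mul_mul (U := 1) (V := P) (by simp)
        (by simpa using hP) (Q 0), Matrix.one_mul, frobSq, Finset.sum_comm]
      simp [hf, dotProduct, Matrix.mulVec, Matrix.mul_apply, sq]
    have hfirst : ∀ a, f 0 (P.col (Fin.castAdd d a)) ⬝ᵥ f 0 (P.col (Fin.castAdd d a)) = 1 / 4 := by
      intro a
      rw [hPe]
      fin_cases a <;> simp [A00, A01, A02, A03, he] <;> norm_num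
    rw [Fin.sum_univ_add, Finset.sum_congr rfl fun a _ => hfirst a] at htot
    simp only [Finset.sum_const, Finset.card_univ, Fintype.card_fin, nsmul_eq_mul] at htot
    intro j
    have hnn : ∀ x : Fin (4 + d) → ℝ, 0 ≤ x ⬝ᵥ x := fun x => by
      simp only [dotProduct]; exact Finset.sum_nonneg fun _ _ => mul_self_nonneg _
    have := (Finset.sum_eq_zero_iff_of_nonneg fun j _ => hnn
      (f 0 (P.col (Fin.natAdd 4 j)))).1 (by norm_num at htot; linarith) j (Finset.mem_univ j)
    exact dotProduct_self_eq_zero.1 this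
  have hker : ∀ a j, f a (P.col (Fin.natAdd 4 j)) = 0 := by
    intro a j
    have h1 : ∀ x, f a (f a x) = f 0 (f 0 x) := fun x => by
      simp only [hf, Matrix.mulVec_mulVec, hQ.sq_eq_sq a 0]
    apply dotProduct_self_eq_zero.1
    rw [fdot, h1, hker0]
    simp [hf]
  -- the third matrix
  set κ := e 3 ⬝ᵥ f 2 v with hκ
  -- In the basis of columns of `P`, the vector `f 2 v` is orthogonal to `v`, `f 0 v`, `f 1 v` and
  -- the common kernel, so only `e 3` is left.
  have h2v : f 2 v = κ • e 3 := by
    have hexp : f 2 v = ∑ i, (P.col i ⬝ᵥ f 2 v) • P.col i := by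
      calc f 2 v = P *ᵥ (Pᵀ *ᵥ f 2 v) := by rw [Matrix.mulVec_mulVec, hP, Matrix.one_mulVec]
        _ = _ := by
          ext i
          simp only [Matrix.mulVec, dotProduct, Finset.sum_apply, Pi.smul_apply, smul_eq_mul,
            Matrix.col_apply, Matrix.transpose_apply, mul_comm]
    have hz : ∀ j, P.col (Fin.natAdd 4 j) ⬝ᵥ f 2 v = 0 := fun j => by
      have := fdot 2 (P.col (Fin.natAdd 4 j)) v
      rw [hker, zero_dotProduct] at this
      linarith
    rw [hexp, Fin.sum_univ_add, Fin.sum_univ_four]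
    simp only [hPe, hz, zero_smul, Finset.sum_const_zero, add_zero]
    rw [e0, e1, e2, fself, smul_dotProduct, smul_dotProduct, horth 0 2 (by decide),
      horth 1 2 (by decide)]
    simp [hκ]
  have hκ2 : κ ^ 2 = 1 / 4 := by
    have := hunit 2
    rw [h2v, smul_dotProduct, dotProduct_smul, he 3 3] at this
    simp only [if_true, smul_eq_mul, mul_one] at this
    rw [sq, this]
  have A20 : f 2 (e 0) = κ • e 3 := h2v
  have A21 : f 2 (e 1) = κ • e 2 := by
    rw [e1, fsmul, fanti 0 2 (by decide), h2v, fsmul, A03]; module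
  have A22 : f 2 (e 2) = (-κ) • e 1 := by
    rw [e2, fsmul, fanti 1 2 (by decide), h2v, fsmul, A13]; module
  have A23 : f 2 (e 3) = (-κ) • e 0 := by
    have h := hv 2
    rw [h2v, fsmul] at h
    calc f 2 (e 3) = (4 * κ ^ 2) • f 2 (e 3) := by rw [hκ2]; norm_num
      _ = (4 * κ) • κ • f 2 (e 3) := by module
      _ = (-κ) • e 0 := by rw [h, e0]; module
  -- Since `κ = ±1 / 2`, the factor `-2 * κ` is the sign that turns the third matrix into its model.
  refine ⟨P, ![1, 1, -2 * κ], hP, hP', ?_, ?_⟩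
  · intro a
    fin_cases a
    · simp
    · simp
    · change (-2 * κ) ^ 2 = 1
      linear_combination 4 * hκ2
  intro a
  rw [← padZero_smul]
  refine transpose_mul_mul_eq_padZero hP' _ ?_ ?_
  · intro b
    simp only [hPe]
    have hκκ : 2 * κ * κ = 2⁻¹ := by linear_combination 2 * hκ2
    rw [Matrix.smul_mulVec, Fin.sum_univ_four]
    change _ • f a (e b) = _
    fin_cases a <;> fin_cases b <;>
      simp [model₄, A00, A01, A02, A03, A10, A11, A12, A13, A20, A21, A22, A23, smul_smul,
        hκκ] <;> module
  · intro j
    rw [Matrix.smul_mulVec]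
    change _ • f a _ = 0
    rw [hker, smul_zero]

end Quaternionic

/-! ### The equality case for real tuples. -/

section Equality
variable {n N : ℕ}

/-- The tuple `A` can be brought to the form `(t M₀, t M₁, t M₂, 0, …, 0)` by the action of the
real orthogonal groups. -/
def HasNormalForm (A : Fin N → Matrix (Fin n) (Fin n) ℝ)
    (M : Fin 3 → Matrix (Fin n) (Fin n) ℝ) : Prop :=
  ∃ (P : Matrix (Fin n) (Fin n) ℝ) (R : Matrix (Fin N) (Fin N) ℝ) (t : ℝ),
    P * Pᵀ = 1 ∧ R * Rᵀ = 1 ∧ 0 ≤ t ∧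
      ∀ k, Pᵀ * rotate R A k * P = if h : (k : ℕ) < 3 then t • M ⟨k, h⟩ else 0

lemma hasNormalForm_of_eq_zero {A : Fin N → Matrix (Fin n) (Fin n) ℝ} (hA : ∀ j, A j = 0)
    (M : Fin 3 → Matrix (Fin n) (Fin n) ℝ) : HasNormalForm A M :=
  ⟨1, 1, 0, by simp, by simp, le_rfl, fun k => by simp [rotate, hA]⟩

/-- Both sides are invariant under `P` and `R` and homogeneous of degree four in `t`, so equality
need only be checked on the model. -/
lemma HasNormalForm.sum_frobSq_lie_eq {A : Fin N → Matrix (Fin n) (Fin n) ℝ}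
    {M : Fin 3 → Matrix (Fin n) (Fin n) ℝ} (h : HasNormalForm A M) (hN : 3 ≤ N) {c : ℝ}
    (hM : ∑ a, ∑ b, frobSq ⁅M a, M b⁆ = c * (∑ a, frobSq (M a)) ^ 2) :
    ∑ j, ∑ k, frobSq ⁅A j, A k⁆ = c * (∑ j, frobSq (A j)) ^ 2 := by
  obtain ⟨d, rfl⟩ := Nat.exists_eq_add_of_le hN
  obtain ⟨P, R, t, hP, hR, -, hform⟩ := h
  have hinv : ∀ X, frobSq (Pᵀ * X * P) = frobSq X := fun X =>
    frobSq_unitary_mul_mul (by simpa using hP) (by simpa using hP) X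
  have hlie : ∀ X Y, frobSq ⁅Pᵀ * X * P, Pᵀ * Y * P⁆ = frobSq ⁅X, Y⁆ := by
    intro X Y
    have e : ∀ X Y, Pᵀ * X * P * (Pᵀ * Y * P) = Pᵀ * (X * Y) * P := fun X Y => by
      calc _ = Pᵀ * X * (P * Pᵀ) * Y * P := by simp only [Matrix.mul_assoc]
        _ = _ := by rw [hP, Matrix.mul_one]; simp only [Matrix.mul_assoc]
    rw [← hinv ⁅X, Y⁆, Ring.lie_def, Ring.lie_def, e, e, Matrix.mul_sub, Matrix.sub_mul]
  have hl : ∀ a : Fin 3, Pᵀ * rotate R A (Fin.castAdd d a) * P = t • M a := fun a => by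
    rw [hform]; simp
  have hr : ∀ i : Fin d, Pᵀ * rotate R A (Fin.natAdd 3 i) * P = 0 := fun i => by
    rw [hform]; simp [-Fin.natAdd_eq_addNat]
  have h0 : ∀ X : Matrix (Fin n) (Fin n) ℝ,
      frobSq ⁅X, (0 : Matrix (Fin n) (Fin n) ℝ)⁆ = 0 := fun X => by simp [Ring.lie_def]
  have h0' : ∀ X : Matrix (Fin n) (Fin n) ℝ,
      frobSq ⁅(0 : Matrix (Fin n) (Fin n) ℝ), X⁆ = 0 := fun X => by simp [Ring.lie_def]
  rw [← sum_frobSq_rotate hR A, ← sum_frobSq_lie_rotate hR A]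
  simp only [← hinv (rotate R A _), ← hlie (rotate R A _)]
  simp only [Fin.sum_univ_add, hl, hr, h0, h0', frobSq_zero, lie_smul_smul, frobSq_smul,
    Finset.sum_const_zero, add_zero, ← Finset.mul_sum, hM]
  ring

/-- Real versions of the three model matrices of size three. -/
def model₃ : Fin 3 → Matrix (Fin 3) (Fin 3) ℝ :=
  ![!![0, 1, 0; -1, 0, 0; 0, 0, 0], !![0, 0, 1; 0, 0, 0; -1, 0, 0],
    !![0, 0, 0; 0, 0, 1; 0, -1, 0]]

lemma sum_frobSq_lie_model₃ :
    ∑ a, ∑ b, frobSq ⁅model₃ a, model₃ b⁆ = 1 / 3 * (∑ a, frobSq (model₃ a)) ^ 2 := by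
  simp [Fin.sum_univ_three, frobSq, model₃, Ring.lie_def]
  norm_num

lemma sum_frobSq_lie_padZero_model₄ (d : ℕ) :
    ∑ a, ∑ b, frobSq ⁅padZero d (model₄ a), padZero d (model₄ b)⁆
      = 2 / 3 * (∑ a, frobSq (padZero d (model₄ a))) ^ 2 := by
  simp only [lie_padZero, frobSq_padZero]
  simp [Fin.sum_univ_three, Fin.sum_univ_four, frobSq, model₄, Ring.lie_def]
  norm_num

lemma hasNormalForm_of_eq {d : ℕ} (hN : 3 ≤ N)
    {A : Fin N → Matrix (Fin (4 + d)) (Fin (4 + d)) ℝ} (hA : ∀ j, (A j)ᵀ = -A j)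
    (h : ∑ j, ∑ k, frobSq ⁅A j, A k⁆ = 2 / 3 * (∑ j, frobSq (A j)) ^ 2) :
    HasNormalForm A fun a => padZero d (model₄ a) := by
  rcases (sum_frobSq_lie_le hA).2 h with h0 | ⟨w, x, Q, hw, hx, hQ, hwA, hker⟩
  · exact hasNormalForm_of_eq_zero h0 _
  obtain ⟨P, ε, hP, hP', hε, hform⟩ := hQ.exists_normalForm
  obtain ⟨e, rfl⟩ := Nat.exists_eq_add_of_le hN
  -- The signs `ε` are absorbed into the columns of `R`, which stay orthonormal.
  obtain ⟨R, hR, hR', hRw⟩ := exists_orthogonal_col_eq (fun a => ε a • w a) (by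
    intro a b
    rw [smul_dotProduct, dotProduct_smul, show w a ⬝ᵥ w b = if a = b then 1 else 0 from hw a b]
    split_ifs with hab
    · subst hab; rw [smul_smul, ← sq, hε]; simp
    · simp)
  have hRw' : ∀ a j, R j (Fin.castAdd e a) = ε a * w a j := fun a j => congrFun (hRw a) j
  have hε0 : ∀ a, ε a ≠ 0 := fun a h0 => by simpa [h0] using hε a
  refine ⟨P, R, x / 2, hP, hR, by positivity, fun k => ?_⟩
  refine Fin.addCases (fun a => ?_) (fun i => ?_) k
  · have h1 : rotate R A (Fin.castAdd e a) = x • ε a • Q a := by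
      simp only [rotate, hRw', ← smul_smul, ← Finset.smul_sum, hwA]
      rw [smul_comm]
    rw [h1, Matrix.mul_smul, Matrix.smul_mul, hform, smul_smul]
    simp [div_eq_mul_inv]
  · have h1 : rotate R A (Fin.natAdd 3 i) = 0 := by
      refine hker _ fun a => ?_
      have h2 := congrFun (congrFun hR' (Fin.castAdd e a)) (Fin.natAdd 3 i)
      rw [Matrix.mul_apply, Matrix.one_apply_ne (by
        simp [Fin.ext_iff, -Fin.natAdd_eq_addNat]; omega)] at h2
      simp only [Matrix.transpose_apply, hRw', mul_assoc, ← Finset.mul_sum] at h2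
      exact (mul_eq_zero.1 h2).resolve_left (hε0 a)
    rw [h1]
    simp [-Fin.natAdd_eq_addNat]

end Equality

/-! ### Size three, through vectors and cross products. -/

section SizeThree
variable {N : ℕ}

/-- Lagrange's identity; it turns commutator sums into minors of a Gram matrix. -/
lemma sum_sum_sq_sub (a b : Fin N → ℝ) :
    ∑ j, ∑ k, (a j * b k - b j * a k) ^ 2 =
      2 * ((∑ j, a j ^ 2) * (∑ j, b j ^ 2) - (∑ j, a j * b j) ^ 2) := by
  have h : ∀ j k, (a j * b k - b j * a k) ^ 2 =
      a j ^ 2 * b k ^ 2 + b j ^ 2 * a k ^ 2 - 2 * ((a j * b j) * (a k * b k)) := fun j k => by ring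
  simp only [h, Finset.sum_sub_distrib, Finset.sum_add_distrib, ← Finset.mul_sum,
    ← Finset.sum_mul]
  ring

lemma eq_of_transpose_eq_neg {A : Matrix (Fin 3) (Fin 3) ℝ} (hA : Aᵀ = -A) :
    A = A 0 1 • model₃ 0 + A 0 2 • model₃ 1 + A 1 2 • model₃ 2 := by
  have h : ∀ i j, A j i = -A i j := fun i j => congrFun (congrFun hA i) j
  have h0 : ∀ i, A i i = 0 := fun i => self_eq_neg.1 (h i i)
  ext i j
  fin_cases i <;> fin_cases j <;> simp [model₃, h0, h 0 1, h 0 2, h 1 2]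

lemma frobSq_of_transpose_eq_neg {A : Matrix (Fin 3) (Fin 3) ℝ} (hA : Aᵀ = -A) :
    frobSq A = 2 * (A 0 1 ^ 2 + A 0 2 ^ 2 + A 1 2 ^ 2) := by
  have h : ∀ i j, A j i = -A i j := fun i j => congrFun (congrFun hA i) j
  have h0 : ∀ i, A i i = 0 := fun i => self_eq_neg.1 (h i i)
  simp [frobSq, Fin.sum_univ_three, h0, h 0 1, h 0 2, h 1 2]
  ring

lemma frobSq_lie_of_transpose_eq_neg {A B : Matrix (Fin 3) (Fin 3) ℝ} (hA : Aᵀ = -A)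
    (hB : Bᵀ = -B) :
    frobSq ⁅A, B⁆ = 2 * ((A 0 1 * B 0 2 - A 0 2 * B 0 1) ^ 2 +
      (A 0 1 * B 1 2 - A 1 2 * B 0 1) ^ 2 + (A 0 2 * B 1 2 - A 1 2 * B 0 2) ^ 2) := by
  have h : ∀ i j, A j i = -A i j := fun i j => congrFun (congrFun hA i) j
  have h0 : ∀ i, A i i = 0 := fun i => self_eq_neg.1 (h i i)
  have h' : ∀ i j, B j i = -B i j := fun i j => congrFun (congrFun hB i) j
  have h0' : ∀ i, B i i = 0 := fun i => self_eq_neg.1 (h' i i)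
  simp [frobSq, Fin.sum_univ_three, Ring.lie_def, Matrix.mul_apply, h0, h 0 1, h 0 2, h 1 2,
    h0', h' 0 1, h' 0 2, h' 1 2]
  ring

/-- The inequality for real skew-symmetric matrices of size three, with its equality case. -/
lemma sum_frobSq_lie_le_three {A : Fin N → Matrix (Fin 3) (Fin 3) ℝ}
    (hA : ∀ j, (A j)ᵀ = -A j) (hN : 3 ≤ N) :
    ∑ j, ∑ k, frobSq ⁅A j, A k⁆ ≤ 1 / 3 * (∑ j, frobSq (A j)) ^ 2 ∧
      (∑ j, ∑ k, frobSq ⁅A j, A k⁆ = 1 / 3 * (∑ j, frobSq (A j)) ^ 2 →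
        HasNormalForm A model₃) := by
  -- Transposed viewpoint: instead of `N` vectors of `ℝ³`, the three coordinate vectors in `ℝᴺ`.
  -- Equality will say that these are orthogonal and of equal length.
  set v : Fin 3 → Fin N → ℝ := ![fun j => A j 0 1, fun j => A j 0 2, fun j => A j 1 2] with hv
  have hAv : ∀ j, A j = ∑ a, v a j • model₃ a := fun j => by
    rw [Fin.sum_univ_three]; exact eq_of_transpose_eq_neg (hA j)
  set p := v 0 ⬝ᵥ v 0 with hp
  set q := v 1 ⬝ᵥ v 1 with hq
  set r := v 2 ⬝ᵥ v 2 with hr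
  have hsq : ∀ a, v a ⬝ᵥ v a = ∑ j, v a j ^ 2 := fun a => by simp [dotProduct, sq]
  have hS : ∑ j, frobSq (A j) = 2 * (p + q + r) := by
    rw [hp, hq, hr, hsq, hsq, hsq,
      Finset.sum_congr rfl fun j _ => frobSq_of_transpose_eq_neg (hA j),
      ← Finset.mul_sum, Finset.sum_add_distrib, Finset.sum_add_distrib]
    rfl
  have hF : ∑ j, ∑ k, frobSq ⁅A j, A k⁆ = 4 * (p * q - (v 0 ⬝ᵥ v 1) ^ 2 +
      (p * r - (v 0 ⬝ᵥ v 2) ^ 2) + (q * r - (v 1 ⬝ᵥ v 2) ^ 2)) := by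
    have h1 : ∀ j k, frobSq ⁅A j, A k⁆ = 2 * ((v 0 j * v 1 k - v 1 j * v 0 k) ^ 2 +
      (v 0 j * v 2 k - v 2 j * v 0 k) ^ 2 + (v 1 j * v 2 k - v 2 j * v 1 k) ^ 2) := fun j k =>
      frobSq_lie_of_transpose_eq_neg (hA j) (hA k)
    simp only [h1, ← Finset.mul_sum, Finset.sum_add_distrib, sum_sum_sq_sub, hp, hq, hr, hsq]
    simp only [dotProduct]
    ring
  rw [hS, hF]
  constructor
  · nlinarith [sq_nonneg (p - q), sq_nonneg (p - r), sq_nonneg (q - r), sq_nonneg (v 0 ⬝ᵥ v 1),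
      sq_nonneg (v 0 ⬝ᵥ v 2), sq_nonneg (v 1 ⬝ᵥ v 2)]
  intro hE
  have hsum : (p - q) ^ 2 + (p - r) ^ 2 + (q - r) ^ 2 + 6 * ((v 0 ⬝ᵥ v 1) ^ 2 +
      (v 0 ⬝ᵥ v 2) ^ 2 + (v 1 ⬝ᵥ v 2) ^ 2) = 0 := by linear_combination -3 / 2 * hE
  have zero : ∀ y : ℝ, y ^ 2 ≤ 0 → y = 0 := fun y hy =>
    pow_eq_zero_iff two_ne_zero |>.1 (le_antisymm hy (sq_nonneg y))
  have n1 := sq_nonneg (p - q)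
  have n2 := sq_nonneg (p - r)
  have n3 := sq_nonneg (q - r)
  have n4 := sq_nonneg (v 0 ⬝ᵥ v 1)
  have n5 := sq_nonneg (v 0 ⬝ᵥ v 2)
  have n6 := sq_nonneg (v 1 ⬝ᵥ v 2)
  have hpq := zero (p - q) (by linarith)
  have hpr := zero (p - r) (by linarith)
  have z01 := zero (v 0 ⬝ᵥ v 1) (by linarith)
  have z02 := zero (v 0 ⬝ᵥ v 2) (by linarith)
  have z12 := zero (v 1 ⬝ᵥ v 2) (by linarith)
  have hgram : ∀ a b, v a ⬝ᵥ v b = if a = b then p else 0 := by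
    intro a b
    fin_cases a <;> fin_cases b <;> simp [z01, z02, z12, dotProduct_comm _ (v 0),
      dotProduct_comm (v 2) (v 1), ← hp, ← hq, ← hr] <;> linarith
  have hp0 : 0 ≤ p := by rw [hp, hsq]; positivity
  rcases hp0.eq_or_lt with hp0 | hp0
  · refine hasNormalForm_of_eq_zero (fun j => ?_) _
    rw [hAv j]
    refine Finset.sum_eq_zero fun a _ => ?_
    have : v a ⬝ᵥ v a = 0 := by rw [hgram, if_pos rfl, hp0]
    rw [dotProduct_self_eq_zero.1 this]
    simp
  obtain ⟨d, rfl⟩ := Nat.exists_eq_add_of_le hN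
  have hs := Real.sqrt_pos.2 hp0
  obtain ⟨R, hR, hR', hRv⟩ := exists_orthogonal_col_eq (fun a => (Real.sqrt p)⁻¹ • v a) (by
    intro a b
    rw [smul_dotProduct, dotProduct_smul, hgram]
    split_ifs with hab
    · rw [smul_smul, smul_eq_mul, ← sq, inv_pow, Real.sq_sqrt hp0.le, inv_mul_cancel₀ hp0.ne']
    · simp)
  have hRv' : ∀ a j, v a j = Real.sqrt p * R j (Fin.castAdd d a) := fun a j => by
    have : R j (Fin.castAdd d a) = (Real.sqrt p)⁻¹ * v a j := congrFun (hRv a) j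
    rw [this, mul_inv_cancel_left₀ hs.ne']
  have hrot : ∀ k, rotate R A k = ∑ a, (if Fin.castAdd d a = k then Real.sqrt p else 0) •
      model₃ a := by
    intro k
    simp only [rotate, hAv, Finset.smul_sum, smul_smul]
    rw [Finset.sum_comm]
    refine Finset.sum_congr rfl fun a _ => ?_
    rw [← Finset.sum_smul]
    congr 1
    have h1 := congrFun (congrFun hR' (Fin.castAdd d a)) k
    rw [Matrix.mul_apply, Matrix.one_apply] at h1
    simp only [Matrix.transpose_apply] at h1
    calc ∑ j, R j k * v a j = Real.sqrt p * ∑ j, R j (Fin.castAdd d a) * R j k := by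
          rw [Finset.mul_sum]
          exact Finset.sum_congr rfl fun j _ => by rw [hRv']; ring
      _ = _ := by rw [h1]; split_ifs <;> simp
  -- No conjugation is needed: the normalized `v a` serve as the first columns of `R`.
  refine ⟨1, R, Real.sqrt p, by simp, hR, hs.le, fun k => ?_⟩
  rw [Matrix.transpose_one, Matrix.one_mul, Matrix.mul_one, hrot]
  refine Fin.addCases (fun a => ?_) (fun i => ?_) k
  · simp [(Fin.castAdd_injective 3 d).eq_iff]
  · rw [dif_neg (by simp [-Fin.natAdd_eq_addNat])]
    refine Finset.sum_eq_zero fun a _ => ?_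
    rw [if_neg (by simp [Fin.ext_iff, -Fin.natAdd_eq_addNat]; omega), zero_smul]

end SizeThree

/-! ### Translation between the complex statement and the real normal form. -/

section Bridge
variable {m n : ℕ}

lemma act_parts {g : K n (m + m)} {P : Matrix (Fin n) (Fin n) ℝ}
    (hP : (g.1 : Matrix (Fin n) (Fin n) ℂ) = toComplex P)
    (B : Fin m → Matrix (Fin n) (Fin n) ℂ) (k : Fin (m + m)) :
    act g (parts B) k = toComplex
      (Pᵀ * rotate (g.2 : Matrix (Fin (m + m)) (Fin (m + m)) ℝ) (realTuple B) k * P) := by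
  have hPt : (toComplex P)ᴴ = toComplex Pᵀ := by ext; simp
  have hsum : ∀ X : Fin (m + m) → Matrix (Fin n) (Fin n) ℝ,
      toComplex (∑ j, X j) = ∑ j, toComplex (X j) := fun X => by
    ext; simp [Matrix.sum_apply]
  rw [rotate, Finset.mul_sum, Finset.sum_mul, hsum, act]
  refine Finset.sum_congr rfl fun j _ => ?_
  rw [hP, hPt, parts_eq_map, Matrix.mul_smul, Matrix.smul_mul, toComplex_smul, toComplex_mul,
    toComplex_mul]

lemma exists_act_eq_triple_iff (B : Fin m → Matrix (Fin n) (Fin n) ℂ)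
    (M : Fin 3 → Matrix (Fin n) (Fin n) ℝ) {X Y Z : ℝ → Matrix (Fin n) (Fin n) ℂ}
    (hX : ∀ t, X t = toComplex (t • M 0)) (hY : ∀ t, Y t = toComplex (t • M 1))
    (hZ : ∀ t, Z t = toComplex (t • M 2)) :
    (∃ g : K n (m + m), IsRealOrthogonal g.1 ∧ ∃ t : ℝ, 0 ≤ t ∧
      act g (parts B) = triple (m + m) (X t) (Y t) (Z t)) ↔ HasNormalForm (realTuple B) M := by
  have htriple : ∀ (t : ℝ) (k : Fin (m + m)), triple (m + m) (X t) (Y t) (Z t) k =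
      toComplex (if h : (k : ℕ) < 3 then t • M ⟨k, h⟩ else 0) := by
    intro t k
    rcases k with ⟨k, hk⟩
    simp only [triple, hX, hY, hZ]
    rcases k with _ | _ | _ | k
    · simp
    · simp
    · simp
    · have h0 : toComplex (0 : Matrix (Fin n) (Fin n) ℝ) = 0 := by ext; simp
      rw [dif_neg (by omega), h0]
      simp
  constructor
  · rintro ⟨g, ⟨P, hP, hgP⟩, t, ht, h⟩
    refine ⟨P, g.2, t, (Matrix.mem_orthogonalGroup_iff _ _).1 hP,
      (Matrix.mem_orthogonalGroup_iff _ _).1 g.2.2, ht, fun k => toComplex_injective ?_⟩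
    rw [← htriple, ← h, act_parts hgP]
  · rintro ⟨P, R, t, hP, hR, ht, h⟩
    have hPU : toComplex P ∈ Matrix.unitaryGroup (Fin n) ℂ := by
      rw [Matrix.mem_unitaryGroup_iff, Matrix.star_eq_conjTranspose,
        show (toComplex P)ᴴ = toComplex Pᵀ by ext; simp, ← toComplex_mul, hP]
      ext i j; simp [Matrix.one_apply, apply_ite]
    refine ⟨⟨⟨toComplex P, hPU⟩, ⟨R, (Matrix.mem_orthogonalGroup_iff _ _).2 hR⟩⟩,
      ⟨P, (Matrix.mem_orthogonalGroup_iff _ _).2 hP, rfl⟩, t, ht, ?_⟩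
    funext k
    rw [act_parts rfl, htriple, ← h]

lemma diagZero_toComplex {k d : ℕ} (M : Matrix (Fin k) (Fin k) ℝ) :
    diagZero (k + d) (toComplex M) = toComplex (padZero d M) := by
  ext i j
  refine Fin.addCases (fun a => ?_) (fun a => ?_) i <;>
  refine Fin.addCases (fun b => ?_) (fun b => ?_) j <;>
    simp [diagZero, -Fin.natAdd_eq_addNat]

lemma diagZero_self {k : ℕ} (M : Matrix (Fin k) (Fin k) ℂ) : diagZero k M = M := by
  ext i j; simp [diagZero]

end Bridge

/-- Both parts of the complex statement follow from their real versions. -/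
lemma complex_of_real {m n : ℕ} {B : Fin m → Matrix (Fin n) (Fin n) ℂ}
    (hB : ∀ r, (B r)ᵀ = -B r) {c : ℝ} {p : Prop}
    (hle : ∑ j, ∑ k, frobSq ⁅realTuple B j, realTuple B k⁆
      ≤ c * (∑ j, frobSq (realTuple B j)) ^ 2)
    (heq : ∑ j, ∑ k, frobSq ⁅realTuple B j, realTuple B k⁆
      = c * (∑ j, frobSq (realTuple B j)) ^ 2 ↔ p) :
    (∑ r, ∑ s, ‖⁅B r, B s⁆‖ ^ 2 ≤ c * (∑ r, ‖B r‖ ^ 2) ^ 2) ∧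
      (∑ r, ∑ s, ‖⁅B r, B s⁆‖ ^ 2 = c * (∑ r, ‖B r‖ ^ 2) ^ 2 ↔
        ∑ r, ⁅B r, conjMatrix (B r)⁆ = 0 ∧ p) := by
  simp only [norm_sq_eq_frobSq]
  rw [sum_frobSq_lie_realTuple hB, sum_frobSq_realTuple] at hle heq
  have h0 := frobSq_nonneg (∑ r, ⁅B r, conjMatrix (B r)⁆)
  -- The commutator sum of `B` is the real one minus a nonnegative term, so reaching the bound means
  -- that the term vanishes and the real bound is attained.
  refine ⟨by linarith, fun h => ?_, fun ⟨hz, hp⟩ => ?_⟩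
  · have hz : frobSq (∑ r, ⁅B r, conjMatrix (B r)⁆) = 0 := by linarith
    exact ⟨frobSq_eq_zero hz, heq.1 (by linarith)⟩
  · have := heq.2 hp
    rw [hz, frobSq_zero] at this
    linarith

end DDVV

theorem corollary2p5 (m n : ℕ) (hm : 3 ≤ m) (B : Fin m → Matrix (Fin n) (Fin n) ℂ)
    (hB : ∀ r, (B r)ᵀ = -B r) :
    (n = 3 →
      (∑ r, ∑ s, ‖⁅B r, B s⁆‖ ^ 2 ≤ (1 / 3 : ℝ) * (∑ r, ‖B r‖ ^ 2) ^ 2) ∧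
      (∑ r, ∑ s, ‖⁅B r, B s⁆‖ ^ 2 = (1 / 3 : ℝ) * (∑ r, ‖B r‖ ^ 2) ^ 2 ↔
        ∑ r, ⁅B r, DDVV.conjMatrix (B r)⁆ = 0 ∧
        ∃ g : DDVV.K n (m + m), DDVV.IsRealOrthogonal g.1 ∧ ∃ t : ℝ, 0 ≤ t ∧
          DDVV.act g (DDVV.parts B) =
            DDVV.triple (m + m) (DDVV.diagZero n (DDVV.C₁ t)) (DDVV.diagZero n (DDVV.C₂ t))
              (DDVV.diagZero n (DDVV.C₃ t)))) ∧
    (4 ≤ n →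
      (∑ r, ∑ s, ‖⁅B r, B s⁆‖ ^ 2 ≤ (2 / 3 : ℝ) * (∑ r, ‖B r‖ ^ 2) ^ 2) ∧
      (∑ r, ∑ s, ‖⁅B r, B s⁆‖ ^ 2 = (2 / 3 : ℝ) * (∑ r, ‖B r‖ ^ 2) ^ 2 ↔
        ∑ r, ⁅B r, DDVV.conjMatrix (B r)⁆ = 0 ∧
        ∃ g : DDVV.K n (m + m), DDVV.IsRealOrthogonal g.1 ∧ ∃ t : ℝ, 0 ≤ t ∧
          DDVV.act g (DDVV.parts B) =
            DDVV.triple (m + m) (DDVV.diagZero n (DDVV.D₁ t)) (DDVV.diagZero n (DDVV.D₂ t))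
              (DDVV.diagZero n (DDVV.D₃ t)))) := by

  have hN : 3 ≤ m + m := by omega
  have hA := DDVV.realTuple_transpose hB
  constructor
  · rintro rfl
    refine DDVV.complex_of_real hB (DDVV.sum_frobSq_lie_le_three hA hN).1
      (Iff.trans ⟨(DDVV.sum_frobSq_lie_le_three hA hN).2,
        fun h => h.sum_frobSq_lie_eq hN DDVV.sum_frobSq_lie_model₃⟩
        (DDVV.exists_act_eq_triple_iff B DDVV.model₃ ?_ ?_ ?_).symm)
    all_goals
      intro t
      rw [DDVV.diagZero_self]
      ext i j
      fin_cases i <;> fin_cases j <;> simp [DDVV.model₃, DDVV.C₁, DDVV.C₂, DDVV.C₃]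
  · intro hn
    obtain ⟨d, rfl⟩ := Nat.exists_eq_add_of_le hn
    refine DDVV.complex_of_real hB (DDVV.sum_frobSq_lie_le hA).1
      (Iff.trans ⟨DDVV.hasNormalForm_of_eq hN hA,
        fun h => h.sum_frobSq_lie_eq hN (DDVV.sum_frobSq_lie_padZero_model₄ d)⟩
        (DDVV.exists_act_eq_triple_iff B (fun a => DDVV.padZero d (DDVV.model₄ a)) ?_ ?_ ?_).symm)
    all_goals
      intro t
      rw [← DDVV.padZero_smul, ← DDVV.diagZero_toComplex]
      congr 1
      ext i j
      fin_cases i <;> fin_cases j <;> simp [DDVV.model₄, DDVV.D₁, DDVV.D₂, DDVV.D₃]
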